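/- **Setting.** Let $\mathfrak g$ be a finite-dimensional simple complex Lie algebra with Cartan subalgebra $\mathfrak h$, a choice of simple roots $\alpha_1,\dots,\alpha_r$, maximal root $\theta$, and the invariant form $(\cdot,\cdot)$ for which long roots have squared norm $2$. Let $\mathfrak n_\pm$ be the sums of the positive and of the negative root spaces, let $\rho\in\mathfrak h$ be the element corresponding under the form to the half-sum of the positive roots, and let $h^\vee=1+\langle\rho,\theta^\vee\rangle$ be the dual Coxeter number. Let $\hat{\mathfrak g}=\mathfrak g[t,t^{-1}]\oplus\mathbb C c$ with $c$ central and $[f,g]=[f,g](t)+\mathrm{Res}_{t=0}(df,g)\,c$. Let $\hat{\mathfrak n}_+=\mathfrak n_+\oplus t\mathfrak g[t]$ and $\hat{\mathfrak n}_-=\mathfrak n_-\oplus t^{-1}\mathfrak g[t^{-1}]$. Fix $e_i\in\mathfrak g_{\alpha_i}$, $f_i\in\mathfrak g_{-\alpha_i}$ ($1\le i\le r$) with $(e_i,f_i)=1$, and $e_\theta\in\mathfrak g_\theta$, $f_\theta\in\mathfrak g_{-\theta}$ with $(e_\theta,f_\theta)=1$; put $e_0=f_\theta\otimes t$, $f_0=e_\theta\otimes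 t^{-1}$, and $\alpha_0=-\theta$ on $\mathfrak h$. For $\mathfrak a=\hat{\mathfrak g}$ or $\mathfrak h$ let $A_{\mathfrak a}=U(\mathfrak a)^*$ be the space of functions on the formal group of $\mathfrak a$, with product dual to the coproduct of $U(\mathfrak a)$. For $X\in U(\mathfrak a)$ put $(L(X)\phi)(u)=\phi(uX)$ and $(R(X)\phi)(u)=\phi(Xu)$. Let $\phi\mapsto\phi|_{\mathfrak h}$ be the map $A_{\hat{\mathfrak g}}\to A_{\mathfrak h}$ dual to $U(\mathfrak h)\to U(\hat{\mathfrak g})$. For $x\in\mathfrak h$ let $\partial_x=L(x)$ on $A_{\mathfrak h}$, and for a linear form $\lambda$ on $\mathfrak h$ let $e^{\lambda(h)}\in A_{\mathfrak h}$ be the function $x_1\cdots x_n\mapsto\lambda(x_1)\cdots\lambda(x_n)$. Let $y_1,\dots,y_r$ be an orthonormal basis of $\mathfrak h$ and write $\partial_i=\partial_{y_i}$. Let $B$ be an orthonormal basis of $\mathfrak g$ and $$\hat C=C+2\sum_{m\ge1}\sum_{a\in B}(a\otimes t^{-m})(a\otimes t^m),\qquad C=\sum_{a\in B}a^2 .$$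 Let $\chi_\pm:U(\hat{\mathfrak n}_\pm)\to\mathbb C$ be algebra homomorphisms and put $\chi_+^i=\chi_+(e_i)$, $\chi_-^i=\chi_-(f_i)$ for $0\le i\le r$. A *Whittaker function* of critical level with characters $\chi_\pm$ is a $\phi\in A_{\hat{\mathfrak g}}$ with $L(c)\phi=-h^\vee\phi$, with $L(X)\phi=\chi_+(X)\phi$ for all $X\in U(\hat{\mathfrak n}_+)$, and with $R(X)\phi=\chi_-(X)\phi$ for all $X\in U(\hat{\mathfrak n}_-)$. **Proposition 2.3.** (1) For every such $\phi$ the series $(L(\hat C)\phi)|_{\mathfrak h}$ is finite: only finitely many of the terms $\big(L((a\otimes t^{-m})(a\otimes t^m))\phi\big)|_{\mathfrak h}$ ($m\ge1$, $a\in B$) are nonzero. Moreover $$(L(\hat C)\phi)|_{\mathfrak h}=\Big(\sum_{i=1}^r\partial_i^2+2\partial_\rho+2\sum_{i=0}^r\chi_+^i\chi_-^i\,e^{-\alpha_i(h)}\Big)\,\phi|_{\mathfrak h}.$$ (2) For any complex numbers $\beta_0,\dots,\beta_r$ let $\hat D'=\sum_i\partial_i^2+2\partial_\rho+2\sum_{i=0}^r\beta_ie^{-\alpha_i(h)}$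 on $A_{\mathfrak h}$, which is the operator in (1) when $\beta_i=\chi_+^i\chi_-^i$. Then $$\hat D:=e^{(\rho,h)}\hat D'e^{-(\rho,h)}=\sum_{i=1}^r\partial_i^2+2\sum_{i=0}^r\beta_ie^{-\alpha_i(h)}-(\rho,\rho).$$ (3) If $\beta_i=-1$ for $1\le i\le r$ and $\beta_0=-K$ with $K\in\mathbb C$, then the change of variable $h\mapsto-h$ transforms $-\tfrac12\big(\hat D+(\rho,\rho)\big)$ into the affine quantum Toda Hamiltonian $$M^K=-\tfrac12\sum_{i=1}^r\partial_i^2+\sum_{i=1}^re^{\alpha_i(h)}+Ke^{-\theta(h)} .$$ -/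

import Mathlib

open LieAlgebra LieAlgebra.IsKilling LieModule
open scoped TensorProduct

noncomputable section

namespace AffineToda

section FormalFunctions

attribute [local instance 100] LieRing.ofAssociativeRing

variable {𝔞 𝔟 : Type*} [LieRing 𝔞] [LieAlgebra ℂ 𝔞] [LieRing 𝔟] [LieAlgebra ℂ 𝔟]

/-- The universal enveloping algebra `U(𝔞)` over `ℂ`. -/
abbrev U (𝔞 : Type*) [LieRing 𝔞] [LieAlgebra ℂ 𝔞] := UniversalEnvelopingAlgebra ℂ 𝔞

/-- The canonical map `𝔞 → U(𝔞)`. -/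
def ι (x : 𝔞) : U 𝔞 := UniversalEnvelopingAlgebra.ι ℂ x

/-- Functoriality of the enveloping algebra. -/
def mapU (f : 𝔞 →ₗ⁅ℂ⁆ 𝔟) : U 𝔞 →ₐ[ℂ] U 𝔟 :=
  UniversalEnvelopingAlgebra.lift ℂ ((UniversalEnvelopingAlgebra.ι ℂ).comp f)

/-- Functions on the formal group of `𝔞`: the full linear dual `U(𝔞)^*`. -/
abbrev Fun (𝔞 : Type*) [LieRing 𝔞] [LieAlgebra ℂ 𝔞] := Module.Dual ℂ (U 𝔞)

/-- The left-invariant differential operator attached to `X ∈ U(𝔞)`: `(L(X)φ)(u) = φ(uX)`. -/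
def L (X : U 𝔞) : Module.End ℂ (Fun 𝔞) := (LinearMap.mulRight ℂ X).dualMap

/-- The right-invariant differential operator attached to `X ∈ U(𝔞)`: `(R(X)φ)(u) = φ(Xu)`. -/
def R (X : U 𝔞) : Module.End ℂ (Fun 𝔞) := (LinearMap.mulLeft ℂ X).dualMap

/-- The coproduct of `U(𝔞)`, for which the elements of `𝔞` are primitive. -/
def coproduct : U 𝔞 →ₐ[ℂ] U 𝔞 ⊗[ℂ] U 𝔞 :=
  UniversalEnvelopingAlgebra.lift ℂ
    { toFun x := ι x ⊗ₜ[ℂ] (1 : U 𝔞) + (1 : U 𝔞) ⊗ₜ[ℂ] ι x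
      map_add' x y := by simp only [ι, map_add, TensorProduct.add_tmul, TensorProduct.tmul_add]; abel
      map_smul' c x := by simp [ι, TensorProduct.smul_tmul']
      map_lie' := by
        intro x y
        simp only [ι, LieHom.map_lie, LieRing.of_associative_ring_bracket, mul_add, add_mul,
          Algebra.TensorProduct.tmul_mul_tmul, one_mul, mul_one, TensorProduct.sub_tmul,
          TensorProduct.tmul_sub]
        abel }

/-- The product of formal functions, dual to the coproduct, as the operator of multiplication
by `f`: `(f ψ)(u) = ∑ f(u₁) ψ(u₂)`. -/
def mul (f : Fun 𝔞) : Module.End ℂ (Fun 𝔞) where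
  toFun ψ := (TensorProduct.lid ℂ ℂ).toLinearMap ∘ₗ TensorProduct.map f ψ ∘ₗ
    (coproduct (𝔞 := 𝔞)).toLinearMap
  map_add' ψ ψ' := by
    ext u; simp [TensorProduct.map_add_right]
  map_smul' c ψ := by
    ext u; simp [TensorProduct.map_smul_right]

/-- The exponential function `h ↦ e^{l(h)}` of a linear form `l` on an abelian Lie algebra: the
formal function whose Taylor coefficients are `x₁ ⋯ xₙ ↦ l(x₁) ⋯ l(xₙ)`. -/
def expFun [IsLieAbelian 𝔞] (l : Module.Dual ℂ 𝔞) : Fun 𝔞 :=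
  (UniversalEnvelopingAlgebra.lift ℂ (LieAlgebra.lieCharacterEquivLinearDual.symm l)).toLinearMap

/-- The pull-back of formal functions on an abelian group along the inversion `h ↦ -h`. -/
def inversion [IsLieAbelian 𝔞] : Module.End ℂ (Fun 𝔞) :=
  (mapU ({ (-LinearMap.id : 𝔞 →ₗ[ℂ] 𝔞) with
    map_lie' := by intro x y; simp [trivial_lie_zero] } : 𝔞 →ₗ⁅ℂ⁆ 𝔞)).toLinearMap.dualMap

end FormalFunctions

section FiniteDimensional

variable {𝔤 : Type*} [LieRing 𝔤] [LieAlgebra ℂ 𝔤] [FiniteDimensional ℂ 𝔤] [IsKilling ℂ 𝔤]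
  (H : LieSubalgebra ℂ 𝔤) [H.IsCartanSubalgebra]

/-- The squared norm of a long root, for the form on `H^*` that is dual to the Killing form. -/
def killingLongNormSq : ℝ :=
  ⨆ α : H.root, ((α : Weight ℂ H 𝔤) ((cartanEquivDual H).symm (α : Weight ℂ H 𝔤).toLinear)).re

/-- The ratio of the normalized invariant form to the Killing form. -/
def formScale : ℂ := ((killingLongNormSq H / 2 : ℝ) : ℂ)

/-- The invariant inner product on `𝔤` for which long roots have squared norm `2`. -/
def form : LinearMap.BilinForm ℂ 𝔤 := formScale H • killingForm ℂ 𝔤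

/-- The isomorphism `H^* → H` given by the normalized form: `(♯l, h) = l(h)`. -/
def sharp (l : Module.Dual ℂ H) : H := (formScale H)⁻¹ • (cartanEquivDual H).symm l

variable {H}

/-- The half-sum of the positive roots, as a linear form on `H`. -/
def rhoForm (b : (rootSystem H).Base) : Module.Dual ℂ H :=
  open scoped Classical in
  (1 / 2 : ℂ) • ∑ α : H.root, if b.IsPos α then (rootSystem H).root α else 0

/-- The element `ρ ∈ H` corresponding to the half-sum of the positive roots under the form. -/
def rho (b : (rootSystem H).Base) : H := sharp H (rhoForm b)

/-- `θ` is the maximal root: every root is obtained from it by subtracting simple roots. -/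
def IsMaximalRoot (b : (rootSystem H).Base) (θ : H.root) : Prop :=
  ∀ α : H.root, (rootSystem H).root θ - (rootSystem H).root α ∈
    AddSubmonoid.closure ((rootSystem H).root '' b.support)

/-- The dual Coxeter number `h^∨ = 1 + ⟨ρ, θ^∨⟩`. -/
def dualCoxeter (b : (rootSystem H).Base) (θ : H.root) : ℂ :=
  1 + rhoForm b ((rootSystem H).coroot θ)

/-- The sum of the root spaces of the positive roots. -/
def nPos (b : (rootSystem H).Base) : Submodule ℂ 𝔤 :=
  ⨆ α : {α : H.root // b.IsPos α}, (rootSpace H (α.1 : Weight ℂ H 𝔤)).toSubmodule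

/-- The sum of the root spaces of the negative (that is, not positive) roots. -/
def nNeg (b : (rootSystem H).Base) : Submodule ℂ 𝔤 :=
  ⨆ α : {α : H.root // ¬ b.IsPos α}, (rootSpace H (α.1 : Weight ℂ H 𝔤)).toSubmodule

lemma lie_mem_iSup_rootSpace (P : H.root → Prop)
    (hadd : ∀ α β γ : H.root, P α → P β →
      (rootSystem H).root γ = (rootSystem H).root α + (rootSystem H).root β → P γ)
    (hneg : ∀ α β : H.root, P α → P β → (rootSystem H).root α + (rootSystem H).root β ≠ 0)
    {x y : 𝔤}
    (hx : x ∈ ⨆ α : {α : H.root // P α}, (rootSpace H (α.1 : Weight ℂ H 𝔤)).toSubmodule)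
    (hy : y ∈ ⨆ α : {α : H.root // P α}, (rootSpace H (α.1 : Weight ℂ H 𝔤)).toSubmodule) :
    ⁅x, y⁆ ∈ ⨆ α : {α : H.root // P α}, (rootSpace H (α.1 : Weight ℂ H 𝔤)).toSubmodule := by
  induction hx using Submodule.iSup_induction' with
  | zero => simp
  | add x x' _ _ h h' => rw [add_lie]; exact add_mem h h'
  | mem α x hx =>
    induction hy using Submodule.iSup_induction' with
    | zero => simp
    | add y y' _ _ h h' => rw [lie_add]; exact add_mem h h'
    | mem β y hy =>
      have hxy := lie_mem_genWeightSpace_of_mem_genWeightSpace (R := ℂ) (H := H) (L := 𝔤)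
        (LieSubmodule.mem_toSubmodule _ |>.1 hx) (LieSubmodule.mem_toSubmodule _ |>.1 hy)
      by_cases h0 : ⁅x, y⁆ = 0
      · rw [h0]; exact zero_mem _
      have hne : genWeightSpace 𝔤 (⇑(α.1 : Weight ℂ H 𝔤) + ⇑(β.1 : Weight ℂ H 𝔤)) ≠ ⊥ := by
        intro h
        rw [h] at hxy
        exact h0 (by simpa using hxy)
      let γ : Weight ℂ H 𝔤 := ⟨_, hne⟩
      have hγ : γ.IsNonZero := by
        intro hz
        apply hneg α.1 β.1 α.2 β.2
        ext h
        exact congrFun hz h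
      have hγ' : γ ∈ H.root := by simpa using hγ
      have hP : P ⟨γ, hγ'⟩ := by
        apply hadd α.1 β.1 ⟨γ, hγ'⟩ α.2 β.2
        ext h
        rfl
      exact Submodule.mem_iSup_of_mem (⟨⟨γ, hγ'⟩, hP⟩ : {α : H.root // P α}) hxy

lemma root_neg (α : H.root) :
    letI := (rootSystem H).indexNeg
    (rootSystem H).root (-α) = -(rootSystem H).root α := by
  simp only [RootPairing.indexNeg_neg, RootPairing.root_reflectionPerm,
    RootPairing.reflection_apply_self]

lemma lie_mem_nPos (b : (rootSystem H).Base) {x y : 𝔤} (hx : x ∈ nPos b) (hy : y ∈ nPos b) :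
    ⁅x, y⁆ ∈ nPos b := by
  refine lie_mem_iSup_rootSpace b.IsPos (fun α β γ hα hβ h ↦ hα.add hβ h) ?_ hx hy
  intro α β hα hβ h
  let := (rootSystem H).indexNeg
  have : β = -α := (rootSystem H).root.injective (by
    rw [root_neg]; exact (neg_eq_of_add_eq_zero_right h).symm)
  exact (RootPairing.Base.IsPos.neg_iff_not b α).1 (this ▸ hβ) hα

lemma lie_mem_nNeg (b : (rootSystem H).Base) {x y : 𝔤} (hx : x ∈ nNeg b) (hy : y ∈ nNeg b) :
    ⁅x, y⁆ ∈ nNeg b := by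
  let := (rootSystem H).indexNeg
  refine lie_mem_iSup_rootSpace (fun α ↦ ¬ b.IsPos α) (fun α β γ hα hβ h hγ ↦ ?_) ?_ hx hy
  · rw [← RootPairing.Base.IsPos.neg_iff_not] at hα hβ
    refine (RootPairing.Base.IsPos.neg_iff_not b γ).1 (hα.add hβ ?_) hγ
    simp only [root_neg, h]
    abel
  · intro α β hα hβ h
    have : β = -α := (rootSystem H).root.injective (by
      rw [root_neg]; exact (neg_eq_of_add_eq_zero_right h).symm)
    exact hβ (this ▸ (RootPairing.Base.IsPos.neg_iff_not b α).2 hα)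

lemma neg_simple_mem_nNeg {b : (rootSystem H).Base} {α : H.root} (hα : α ∈ b.support) {x : 𝔤}
    (hx : x ∈ rootSpace H (-(α : Weight ℂ H 𝔤))) : x ∈ nNeg b := by
  let := (rootSystem H).indexNeg
  have hneg : ¬ b.IsPos (-α) := fun h ↦
    (RootPairing.Base.IsPos.neg_iff_not b α).1 h (RootPairing.Base.isPos_of_mem_support hα)
  have hcoe : ⇑((-α : H.root) : Weight ℂ H 𝔤) = -⇑(α : Weight ℂ H 𝔤) := by
    ext h
    exact LinearMap.congr_fun (root_neg α) h
  refine Submodule.mem_iSup_of_mem ⟨-α, hneg⟩ ?_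
  rw [hcoe]
  exact hx

end FiniteDimensional

section Affine

variable {𝔤 : Type*} [LieRing 𝔤] [LieAlgebra ℂ 𝔤] [FiniteDimensional ℂ 𝔤] [IsKilling ℂ 𝔤]
  (H : LieSubalgebra ℂ 𝔤) [H.IsCartanSubalgebra]

lemma form_lieInvariant : (form H).lieInvariant 𝔤 := by
  intro x y z
  have := traceForm_lieInvariant ℂ 𝔤 𝔤 x y z
  simp only [form, LinearMap.smul_apply, smul_eq_mul, killingForm, this, mul_neg]

lemma form_isSymm : (form H).IsSymm := by
  refine ⟨fun x y ↦ ?_⟩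
  simp [form, LieModule.traceForm_comm ℂ 𝔤 𝔤 x y]

/-- The 2-cocycle `(f, g) ↦ Res_{t=0} (df, g)` on the loop algebra `𝔤[t, t⁻¹]`; it is minus the
cocycle `Res_{t=0} (f, dg)`. -/
def loopCocycle : Cohomology.twoCocycle ℂ (loopAlgebra ℂ ℤ 𝔤)
    (TrivialLieModule ℂ (loopAlgebra ℂ ℤ 𝔤) ℂ) :=
  (-1 : ℂ) • LoopAlgebra.twoCocycleOfBilinear ℂ ℤ 𝔤 (form H) (form_lieInvariant H) (form_isSymm H)

/-- The affine Lie algebra `𝔤[t, t⁻¹] ⊕ ℂ c` with the bracket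
`[f, g] = [f, g](t) + Res_{t=0} (df, g) c`. -/
abbrev Affine : Type _ := LieAlgebra.ofTwoCocycle (loopCocycle H)

/-- The element `x ⊗ t^m + z c` of the affine Lie algebra. -/
def Affine.mk (x : 𝔤) (m : ℤ) (z : ℂ) : Affine H :=
  LieAlgebra.ofProd (loopCocycle H)
    (AddMonoidAlgebra.single m (1 : ℂ) ⊗ₜ[ℂ] x, (TrivialLieModule.equiv ℂ (loopAlgebra ℂ ℤ 𝔤) ℂ).symm z)

/-- The element `x ⊗ t^m` of the affine Lie algebra. -/
abbrev loop (x : 𝔤) (m : ℤ) : Affine H := Affine.mk H x m 0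

/-- The central element `c` of the affine Lie algebra. -/
abbrev central : Affine H := Affine.mk H 0 0 1

lemma loopCocycle_tmul (x y : 𝔤) (m n : ℤ) :
    (loopCocycle H : loopAlgebra ℂ ℤ 𝔤 →ₗ[ℂ] loopAlgebra ℂ ℤ 𝔤 →ₗ[ℂ] _)
      (AddMonoidAlgebra.single m (1 : ℂ) ⊗ₜ[ℂ] x) (AddMonoidAlgebra.single n (1 : ℂ) ⊗ₜ[ℂ] y) =
    (TrivialLieModule.equiv ℂ (loopAlgebra ℂ ℤ 𝔤) ℂ).symm
      (if m + n = 0 then (m : ℂ) * form H x y else 0) := by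
  change (-1 : ℂ) • (TrivialLieModule.equiv ℂ (loopAlgebra ℂ ℤ 𝔤) ℂ).symm
    (LoopAlgebra.residuePairing ℂ ℤ 𝔤 (form H) _ _) = _
  rw [← map_smul]
  congr 1
  simp only [LoopAlgebra.residuePairing_apply_apply, LoopAlgebra.toFinsupp_single_tmul]
  rw [Finsupp.sum_single_index (by simp)]
  by_cases h : m + n = 0
  · obtain rfl : n = -m := by lia
    simp
  · rw [Finsupp.single_eq_of_ne (by lia)]
    simp [h]

lemma Affine.mk_add (x y : 𝔤) (m : ℤ) (z w : ℂ) :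
    Affine.mk H (x + y) m (z + w) = Affine.mk H x m z + Affine.mk H y m w := by
  simp only [Affine.mk, ← LieAlgebra.of_add, TensorProduct.tmul_add, map_add, Prod.mk_add_mk]

lemma Affine.mk_smul (a : ℂ) (x : 𝔤) (m : ℤ) (z : ℂ) :
    Affine.mk H (a • x) m (a * z) = a • Affine.mk H x m z := by
  simp only [Affine.mk, ← LieAlgebra.of_smul, TensorProduct.tmul_smul, ← smul_eq_mul, map_smul,
    Prod.smul_mk]

lemma Affine.lie_mk (x y : 𝔤) (m n : ℤ) (z w : ℂ) :
    ⁅Affine.mk H x m z, Affine.mk H y n w⁆ =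
      Affine.mk H ⁅x, y⁆ (m + n) (if m + n = 0 then (m : ℂ) * form H x y else 0) := by
  rw [Affine.mk, Affine.mk, LieAlgebra.bracket_ofTwoCocycle, Affine.mk]
  refine congrArg (LieAlgebra.ofProd _) (Prod.ext ?_ ?_)
  · simp only [Equiv.symm_apply_apply]
    rw [LieAlgebra.ExtendScalars.bracket_tmul, AddMonoidAlgebra.single_mul_single, mul_one]
  · simp only [Equiv.symm_apply_apply, loopCocycle_tmul]
    rw [LieModule.IsTrivial.trivial, LieModule.IsTrivial.trivial, add_zero, sub_zero]

/-- The embedding of `𝔤` into the affine Lie algebra as constant loops. -/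
def const : 𝔤 →ₗ⁅ℂ⁆ Affine H where
  toFun x := loop H x 0
  map_add' x y := by simpa using Affine.mk_add H x y 0 0 0
  map_smul' c x := by simpa using Affine.mk_smul H c x 0 0
  map_lie' := by
    intro x y
    rw [Affine.lie_mk, add_zero, if_pos rfl, Int.cast_zero, zero_mul]

/-- The span of the loops `x ⊗ t^m` with `m ∈ S` and of the constant loops with values in `N`. -/
def loopSpan (S : Set ℤ) (N : Submodule ℂ 𝔤) : Submodule ℂ (Affine H) :=
  Submodule.span ℂ {u | ∃ (x : 𝔤) (m : ℤ), (m ∈ S ∨ m = 0 ∧ x ∈ N) ∧ u = loop H x m}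

lemma lie_mem_loopSpan (S : Set ℤ) (N : Submodule ℂ 𝔤)
    (hS : ∀ m ∈ S, ∀ n ∈ S, m + n ∈ S) (h0 : 0 ∉ S)
    (hN : ∀ x ∈ N, ∀ y ∈ N, ⁅x, y⁆ ∈ N) {u v : Affine H}
    (hu : u ∈ loopSpan H S N) (hv : v ∈ loopSpan H S N) : ⁅u, v⁆ ∈ loopSpan H S N := by
  induction hu, hv using Submodule.span_induction₂ with
  | zero_left y hy => simp
  | zero_right x hx => simp
  | add_left x y z _ _ _ h h' => rw [add_lie]; exact add_mem h h'
  | add_right x y z _ _ _ h h' => rw [lie_add]; exact add_mem h h'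
  | smul_left r x y _ _ h => rw [smul_lie]; exact Submodule.smul_mem _ _ h
  | smul_right r x y _ _ h => rw [lie_smul]; exact Submodule.smul_mem _ _ h
  | mem_mem u v hu hv =>
    obtain ⟨x, m, hm, rfl⟩ := hu
    obtain ⟨y, n, hn, rfl⟩ := hv
    have hz : (if m + n = 0 then (m : ℂ) * form H x y else 0) = 0 := by
      split_ifs with h
      · rcases hm with hm | ⟨rfl, -⟩
        · rcases hn with hn | ⟨rfl, -⟩
          · exact absurd (h ▸ hS m hm n hn) h0
          · exact absurd ((by lia : m = 0) ▸ hm) h0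
        · simp
      · rfl
    rw [Affine.lie_mk, hz]
    refine Submodule.subset_span ⟨⁅x, y⁆, m + n, ?_, rfl⟩
    rcases hm with hm | ⟨rfl, hx⟩ <;> rcases hn with hn | ⟨rfl, hy⟩
    · exact Or.inl (hS m hm n hn)
    · left; simpa using hm
    · left; simpa using hn
    · exact Or.inr ⟨by simp, hN x hx y hy⟩

variable {H}

/-- The subalgebra `𝔫̂₊` of loops that are regular at `t = 0` with value at `0` in `𝔫₊`. -/
def affNPos (b : (rootSystem H).Base) : LieSubalgebra ℂ (Affine H) where
  __ := loopSpan H (Set.Ioi 0) (nPos b)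
  lie_mem' hu hv := lie_mem_loopSpan H _ _
    (fun _ hm _ hn ↦ Set.mem_Ioi.2 (add_pos (Set.mem_Ioi.1 hm) (Set.mem_Ioi.1 hn)))
    (fun h ↦ lt_irrefl 0 (Set.mem_Ioi.1 h))
    (fun _ hx _ hy ↦ lie_mem_nPos b hx hy) hu hv

/-- The subalgebra `𝔫̂₋` of loops that are regular at `t = ∞` with value at `∞` in `𝔫₋`. -/
def affNNeg (b : (rootSystem H).Base) : LieSubalgebra ℂ (Affine H) where
  __ := loopSpan H (Set.Iio 0) (nNeg b)
  lie_mem' hu hv := lie_mem_loopSpan H _ _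
    (fun _ hm _ hn ↦ Set.mem_Iio.2 (add_neg (Set.mem_Iio.1 hm) (Set.mem_Iio.1 hn)))
    (fun h ↦ lt_irrefl 0 (Set.mem_Iio.1 h))
    (fun _ hx _ hy ↦ lie_mem_nNeg b hx hy) hu hv

/-- Simple root vectors `e_i ∈ 𝔤_{α_i}`, `f_i ∈ 𝔤_{-α_i}` of `𝔤`, and root vectors for `±θ`, each
pair being dual with respect to the invariant form. -/
structure RootVectors (b : (rootSystem H).Base) (θ : H.root) where
  /-- the root vectors for the simple roots -/
  e : b.support → 𝔤
  /-- the root vectors for the negatives of the simple roots -/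
  f : b.support → 𝔤
  /-- the root vector for the maximal root -/
  eθ : 𝔤
  /-- the root vector for the negative of the maximal root -/
  fθ : 𝔤
  e_mem : ∀ i, e i ∈ rootSpace H (i.1 : Weight ℂ H 𝔤)
  f_mem : ∀ i, f i ∈ rootSpace H (-(i.1 : Weight ℂ H 𝔤))
  eθ_mem : eθ ∈ rootSpace H (θ : Weight ℂ H 𝔤)
  fθ_mem : fθ ∈ rootSpace H (-(θ : Weight ℂ H 𝔤))
  form_e_f : ∀ i, form H (e i) (f i) = 1
  form_eθ_fθ : form H eθ fθ = 1

namespace RootVectors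

variable {b : (rootSystem H).Base} {θ : H.root} (v : RootVectors b θ)

/-- The simple root vectors `e_i` (`i = 0, …, r`) of the affine Lie algebra; the index `0` is `none`
and `e_0 = f_θ ⊗ t`. -/
def affE : Option b.support → affNPos b
  | none => ⟨loop H v.fθ 1, Submodule.subset_span ⟨_, _, Or.inl (by simp), rfl⟩⟩
  | some i => ⟨loop H (v.e i) 0, Submodule.subset_span ⟨_, _, Or.inr ⟨rfl,
      Submodule.mem_iSup_of_mem ⟨i.1, RootPairing.Base.isPos_of_mem_support i.2⟩ (v.e_mem i)⟩, rfl⟩⟩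

/-- The simple root vectors `f_i` (`i = 0, …, r`) of the affine Lie algebra; the index `0` is `none`
and `f_0 = e_θ ⊗ t⁻¹`. -/
def affF : Option b.support → affNNeg b
  | none => ⟨loop H v.eθ (-1), Submodule.subset_span ⟨_, _, Or.inl (by simp), rfl⟩⟩
  | some i => ⟨loop H (v.f i) 0, Submodule.subset_span ⟨_, _, Or.inr ⟨rfl, neg_simple_mem_nNeg i.2 (v.f_mem i)⟩, rfl⟩⟩

end RootVectors

/-- The restriction `φ ↦ φ|_h` of formal functions, dual to `U(H) → U(𝔤̂)`. -/
def res : Fun (Affine H) →ₗ[ℂ] Fun H := (mapU ((const H).comp H.incl)).toLinearMap.dualMap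

/-- Whittaker functions of critical level `-h^∨` with characters `χ₊`, `χ₋`. -/
structure IsWhittaker (b : (rootSystem H).Base) (θ : H.root)
    (χp : U (affNPos b) →ₐ[ℂ] ℂ) (χm : U (affNNeg b) →ₐ[ℂ] ℂ) (φ : Fun (Affine H)) : Prop where
  level : L (ι (central H)) φ = (-dualCoxeter b θ) • φ
  right : ∀ X : U (affNPos b), L (mapU (affNPos b).incl X) φ = χp X • φ
  left : ∀ X : U (affNNeg b), R (mapU (affNNeg b).incl X) φ = χm X • φ

section Operators

variable {κ : Type*} [Fintype κ]

/-- The quadratic Casimir `C = ∑_{a ∈ B} a²` of `𝔤`, for an orthonormal basis `B`. -/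
def casimir (B : κ → 𝔤) : U 𝔤 := ∑ a, ι (B a) * ι (B a)

/-- The monomials `(a ⊗ t^{-m})(a ⊗ t^m)`, `m ≥ 1`, `a ∈ B`. -/
def casimirMonomial (B : κ → 𝔤) (p : ℕ+ × κ) : U (Affine H) :=
  ι (loop H (B p.2) (-((p.1 : ℕ) : ℤ))) * ι (loop H (B p.2) ((p.1 : ℕ) : ℤ))

/-- The simple affine roots restricted to `H`: `α_0 = -θ` (index `none`), and the simple roots
`α_1, …, α_r` of `𝔤`. -/
def affRoot (b : (rootSystem H).Base) (θ : H.root) : Option b.support → Module.Dual ℂ H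
  | none => -(rootSystem H).root θ
  | some i => (rootSystem H).root i

/-- The derivation `∂_x` of the algebra of formal functions on `H` given by `x ∈ H`. -/
def deriv (x : H) : Module.End ℂ (Fun H) := L (ι x)

/-- The Laplacian `∑ ∂_i²` of the orthonormal basis `y` of `H`. -/
def laplacian (y : κ → H) : Module.End ℂ (Fun H) := ∑ i, deriv (y i) * deriv (y i)

/-- The multiplication operator by `∑_{i=0}^r β_i e^{-α_i(h)}`. -/
def potential (b : (rootSystem H).Base) (θ : H.root) (β : Option b.support → ℂ) :
    Module.End ℂ (Fun H) :=
  ∑ i, β i • mul (expFun (-affRoot b θ i))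

/-- The operator `∑ ∂_i² + 2 ∂_ρ + 2 ∑_{i=0}^r β_i e^{-α_i(h)}`. -/
def radialPart (b : (rootSystem H).Base) (θ : H.root) (y : κ → H) (β : Option b.support → ℂ) :
    Module.End ℂ (Fun H) :=
  laplacian y + (2 : ℂ) • deriv (rho b) + (2 : ℂ) • potential b θ β

/-- The linear form `h ↦ (x, h)` on `H`. -/
def innerForm (x : H) : Module.Dual ℂ H := form H x ∘ₗ H.toSubmodule.subtype

/-- The conjugate `e^{(ρ,h)} D e^{-(ρ,h)}` of an operator `D`. -/
def conjRho (b : (rootSystem H).Base) (D : Module.End ℂ (Fun H)) : Module.End ℂ (Fun H) :=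
  mul (expFun (innerForm (rho b))) * D * mul (expFun (-innerForm (rho b)))

/-- The affine quantum Toda Hamiltonian `-½ Δ + ∑_{i=1}^r e^{α_i(h)} + K e^{-θ(h)}`. -/
def affineToda (b : (rootSystem H).Base) (θ : H.root) (y : κ → H) (K : ℂ) :
    Module.End ℂ (Fun H) :=
  (-(1 / 2) : ℂ) • laplacian y + ∑ i : b.support, mul (expFun ((rootSystem H).root i)) +
    K • mul (expFun (-(rootSystem H).root θ))

end Operators

end Affine

end AffineToda

end

/-! The radial part of the affine Casimir operator on Whittaker functions.

Let `e_α`, `f_α` be dual root vectors for the positive roots `α` and `y_i` an orthonormal basis of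
`H`. The canonical element of `𝔤 ⊗ 𝔤` does not depend on the dual bases used to write it
(`sum_bilin_eq_root_decomposition`), so that the finite Casimir is
`∑ y_i² + ∑ (e_α f_α + f_α e_α) = ∑ y_i² + 2ρ + 2 ∑ f_α e_α`, because `[e_α, f_α] = ♯α`. Likewise,
for each `m ≥ 1` the sum of the monomials `(a ⊗ t^{-m})(a ⊗ t^m)` is taken over this adapted
basis. Everything is then normally ordered: a product `XY`, with `X ∈ 𝔫̂₋` of weight `l` under `H` and
`Y ∈ 𝔫̂₊`, acts on the restriction of a Whittaker function as `χ₊(Y) χ₋(X) e^l`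
(`IsWhittaker.resL₂_eq`). Here `Y` is absorbed on the right by `χ₊`, while `X` has to cross `u ∈ U(H)`
before it is absorbed on the left by `χ₋`; crossing translates `u` by `l`, and the transpose of that
translation is multiplication by `e^l` (`mul_expFun_apply`).

What remains is to see that `χ₊` kills every adapted basis vector except the affine simple root
vectors. Being a character it vanishes on brackets. As `𝔤` is perfect, it vanishes on `t^m 𝔤` for
`m ≥ 2`, whence the finiteness. In degrees `0` and `1` one uses that `[𝔤_α, 𝔤_β] = 𝔤_{α+β}` when
`α + β` is a root (`exists_lie_eq_of_mem_rootSpace`): a nonsimple positive root is a sum of a simple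
and a positive root, and to a positive root different from `θ` a positive root can be added
(`exists_isPos_root_add`), so that only `e_1, …, e_r` and `f_θ ⊗ t` survive.

On functions on `H`, multiplications by exponentials and derivatives are all transposes of explicit
algebra maps of `U(H)`: conjugation by `e^{(ρ,h)}` replaces `x ∈ H` by `x - (ρ, x)`, and the
inversion replaces it by `-x`. The two statements on the Toda operators follow by expanding. -/

noncomputable section

namespace AffineToda

/-! ### Root spaces and positive roots -/

section RootSpaces

variable {𝔤 : Type*} [LieRing 𝔤] [LieAlgebra ℂ 𝔤] [FiniteDimensional ℂ 𝔤] [IsKilling ℂ 𝔤]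
  {H : LieSubalgebra ℂ 𝔤} [H.IsCartanSubalgebra]

lemma exists_smul_eq_of_mem_rootSpace {α : Weight ℂ H 𝔤} (hα : α.IsNonZero) {x z : 𝔤}
    (hx : x ∈ rootSpace H α) (hx0 : x ≠ 0) (hz : z ∈ rootSpace H α) : ∃ c : ℂ, c • x = z := by
  obtain ⟨c, hc⟩ := (finrank_eq_one_iff_of_nonzero' (⟨x, hx⟩ : rootSpace H α)
    (by simpa using hx0)).mp (finrank_rootSpace_eq_one α hα) ⟨z, hz⟩
  exact ⟨c, congrArg Subtype.val hc⟩

/-- If `α`, `β` and `α + β` are roots then `[𝔤_α, 𝔤_β] = 𝔤_{α + β}`: the `α`-string through `β` is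
an irreducible `𝔰𝔩₂`-module, and `e_α` is nonzero on all its weight vectors but the top one. -/
lemma exists_lie_eq_of_mem_rootSpace {α β γ : Weight ℂ H 𝔤} (hα : α.IsNonZero)
    (hγ : γ.IsNonZero) (h : ⇑γ = ⇑α + ⇑β) {z : 𝔤} (hz : z ∈ rootSpace H γ) :
    ∃ x ∈ rootSpace H α, ∃ y ∈ rootSpace H β, ⁅x, y⁆ = z := by
  obtain ⟨w, hw, hw0⟩ := (chainTop α β).exists_ne_zero
  obtain ⟨h', e, f, t, he, hf⟩ := exists_isSl2Triple_of_weight_isNonZero hα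
  obtain rfl := t.h_eq_coroot hα he hf
  have prim : t.HasPrimitiveVectorWith w (chainLength α β : ℂ) :=
    have := lie_mem_genWeightSpace_of_mem_genWeightSpace he hw
    ⟨hw0, (chainLength_smul _ _ hw).symm, by rwa [genWeightSpace_add_chainTop _ _ hα] at this⟩
  have htop : 1 ≤ chainTopCoeff α β := by
    have := ((rootSpace_zsmul_add_ne_bot_iff α β hα 1).1 (by
      rw [one_smul, ← h]; exact γ.genWeightSpace_ne_bot)).1
    exact_mod_cast this
  obtain ⟨n, hn⟩ := Nat.exists_eq_add_of_le' htop
  have hlen : n + 1 ≤ chainLength α β := hn ▸ chainTopCoeff_le_chainLength α β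
  have hy : (toEnd ℂ 𝔤 𝔤 f ^ (n + 1)) w ∈ rootSpace H β := by
    have := toEnd_pow_apply_mem hf hw (n + 1)
    rwa [coe_chainTop, hn, ← add_assoc, ← Nat.cast_smul_eq_nsmul ℤ, smul_neg, neg_add_cancel,
      zero_add] at this
  have hey := prim.lie_e_pow_succ_toEnd_f n
  have hne : ⁅e, (toEnd ℂ 𝔤 𝔤 f ^ (n + 1)) w⁆ ≠ 0 := by
    rw [hey]
    refine smul_ne_zero (mul_ne_zero (by exact_mod_cast n.succ_ne_zero) ?_)
      (prim.pow_toEnd_f_ne_zero_of_eq_nat rfl (by lia))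
    rw [sub_ne_zero, Ne, Nat.cast_inj]
    lia
  have hmem : ⁅e, (toEnd ℂ 𝔤 𝔤 f ^ (n + 1)) w⁆ ∈ rootSpace H γ := by
    rw [h]; exact lie_mem_genWeightSpace_of_mem_genWeightSpace he hy
  obtain ⟨c, hc⟩ := exists_smul_eq_of_mem_rootSpace hγ hmem hne hz
  exact ⟨e, he, c • _, Submodule.smul_mem _ c hy, by rw [lie_smul, hc]⟩

/-- A root that is a nonnegative combination of simple roots is positive. -/
lemma isPos_of_root_mem_closure {b : (rootSystem H).Base} {α : H.root}
    (hα : (rootSystem H).root α ∈ AddSubmonoid.closure ((rootSystem H).root '' b.support)) :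
    b.IsPos α := by
  classical
  have key : ∀ m ∈ AddSubmonoid.closure ((rootSystem H).root '' b.support),
      ∃ f : H.root → ℕ, m = ∑ j ∈ b.support, (f j : ℤ) • (rootSystem H).root j := by
    intro m hm
    induction hm using AddSubmonoid.closure_induction with
    | mem m hm =>
      obtain ⟨j, hj, rfl⟩ := hm
      refine ⟨Pi.single j 1, ?_⟩
      rw [Finset.sum_eq_single_of_mem j (by simpa using hj)]
      · simp
      · intro i _ hij; simp [hij]
    | zero => exact ⟨0, by simp⟩
    | add m n _ _ hm hn =>
      obtain ⟨f, rfl⟩ := hm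
      obtain ⟨g, rfl⟩ := hn
      exact ⟨f + g, by simp [add_smul, Finset.sum_add_distrib]⟩
  obtain ⟨f, hf⟩ := key _ hα
  rw [RootPairing.Base.isPos_iff', RootPairing.Base.height_eq_sum (f := fun j ↦ (f j : ℤ)) hf]
  exact Finset.sum_nonneg fun j _ ↦ by positivity

/-- A positive root is simple or the sum of a simple root and a positive root. -/
lemma exists_root_eq_simple_add {b : (rootSystem H).Base} {α : H.root} (hα : b.IsPos α)
    (hs : α ∉ b.support) :
    ∃ i ∈ b.support, ∃ β : H.root, b.IsPos β ∧
      (rootSystem H).root α = (rootSystem H).root i + (rootSystem H).root β := by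
  obtain ⟨i, hi, hp⟩ := hα.exists_mem_support_pos_pairingIn
  obtain ⟨β, hβ⟩ := (rootSystem H).root_sub_root_mem_of_pairingIn_pos
    (((rootSystem H).zero_lt_pairingIn_iff' ℤ).1 hp) (fun h : α = i ↦ hs (h ▸ hi))
  exact ⟨i, hi, β, hα.sub hi hβ, by rw [hβ]; abel⟩

/-- To each positive root other than the maximal one a positive root can be added. -/
lemma exists_isPos_root_add {b : (rootSystem H).Base} {θ α : H.root} (hθ : IsMaximalRoot b θ)
    (hα : b.IsPos α) (hne : α ≠ θ) :
    ∃ β γ : H.root, b.IsPos β ∧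
      (rootSystem H).root γ = (rootSystem H).root α + (rootSystem H).root β := by
  by_contra! hno
  have hsimple : ∀ j ∈ b.support, 0 ≤ (rootSystem H).pairingIn ℤ j α := by
    intro j hj
    by_contra! hlt
    have hjpos := RootPairing.Base.isPos_of_mem_support hj
    obtain ⟨γ, hγ⟩ := (rootSystem H).root_add_root_mem_of_pairingIn_neg hlt (fun h ↦ by
      let := (rootSystem H).indexNeg
      have : j = -α := (rootSystem H).root.injective (by rw [root_neg]; exact h)
      exact (RootPairing.Base.IsPos.neg_iff_not b α).1 (this ▸ hjpos) hα)
    exact hno j γ hjpos (by rw [hγ, add_comm])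
  have hclos : ∀ m ∈ AddSubmonoid.closure ((rootSystem H).root '' b.support),
      ∃ n : ℕ, (rootSystem H).toLinearMap m ((rootSystem H).coroot α) = n := by
    intro m hm
    induction hm using AddSubmonoid.closure_induction with
    | mem m hm =>
      obtain ⟨j, hj, rfl⟩ := hm
      obtain ⟨n, hn⟩ := Int.eq_ofNat_of_zero_le (hsimple j hj)
      refine ⟨n, ?_⟩
      rw [RootPairing.root_coroot_eq_pairing, ← (rootSystem H).algebraMap_pairingIn ℤ, hn]
      simp
    | zero => exact ⟨0, by simp⟩
    | add m n _ _ hm hn =>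
      obtain ⟨k, hk⟩ := hm
      obtain ⟨l, hl⟩ := hn
      exact ⟨k + l, by rw [map_add, LinearMap.add_apply, hk, hl]; push_cast; rfl⟩
  -- If no simple root can be added to `α`, then `⟨θ, α^∨⟩ = 2 + ⟨θ - α, α^∨⟩ > 0`, so `θ - α` is
  -- a root.
  obtain ⟨n, hn⟩ := hclos _ (hθ α)
  have hpos : 0 < (rootSystem H).pairingIn ℤ θ α := by
    rw [map_sub, LinearMap.sub_apply, RootPairing.root_coroot_eq_pairing,
      RootPairing.root_coroot_eq_pairing, RootPairing.pairing_same,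
      ← (rootSystem H).algebraMap_pairingIn ℤ, sub_eq_iff_eq_add] at hn
    have : (rootSystem H).pairingIn ℤ θ α = n + 2 := by
      exact_mod_cast (show (((rootSystem H).pairingIn ℤ θ α : ℤ) : ℂ) = _ from hn)
    lia
  obtain ⟨β, hβ⟩ := (rootSystem H).root_sub_root_mem_of_pairingIn_pos hpos (Ne.symm hne)
  exact hno β θ (isPos_of_root_mem_closure (hβ ▸ hθ α)) (by rw [hβ]; abel)

end RootSpaces

/-! ### The invariant form and dual bases -/

section InvariantForm

variable {𝔤 : Type*} [LieRing 𝔤] [LieAlgebra ℂ 𝔤] [FiniteDimensional ℂ 𝔤] [IsKilling ℂ 𝔤]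
  {H : LieSubalgebra ℂ 𝔤} [H.IsCartanSubalgebra]

lemma form_apply (x y : 𝔤) : form H x y = formScale H * killingForm ℂ 𝔤 x y := rfl

lemma form_comm (x y : 𝔤) : form H x y = form H y x := by
  simp only [form_apply, LieModule.traceForm_comm ℂ 𝔤 𝔤 x y]

lemma form_eq_zero_of_add_ne_zero {α β : H → ℂ} {x y : 𝔤} (hx : x ∈ rootSpace H α)
    (hy : y ∈ rootSpace H β) (h : α + β ≠ 0) : form H x y = 0 := by
  rw [form_apply, killingForm_apply_eq_zero_of_mem_rootSpace_of_add_ne_zero ℂ 𝔤 H hx hy h,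
    mul_zero]

omit [IsKilling ℂ 𝔤] in
lemma coe_mem_rootSpace_zero (h : H) : (h : 𝔤) ∈ rootSpace H (0 : H → ℂ) := by
  rw [rootSpace_zero_eq ℂ 𝔤 H]; exact h.2

lemma form_coe_eq_zero (α : H.root) {x : 𝔤} (h : H)
    (hx : x ∈ rootSpace H (α : Weight ℂ H 𝔤)) : form H (h : 𝔤) x = 0 := by
  refine form_eq_zero_of_add_ne_zero (coe_mem_rootSpace_zero h) hx ?_
  rw [zero_add]
  exact LieSubalgebra.isNonZero_coe_root α

lemma form_coe_eq_zero_neg (α : H.root) {x : 𝔤} (h : H)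
    (hx : x ∈ rootSpace H (-(α : Weight ℂ H 𝔤))) : form H (h : 𝔤) x = 0 := by
  refine form_eq_zero_of_add_ne_zero (coe_mem_rootSpace_zero h) hx ?_
  rw [zero_add, neg_ne_zero]
  exact LieSubalgebra.isNonZero_coe_root α

lemma lie_eq_form_smul_sharp (hs : formScale H ≠ 0) {α : Weight ℂ H 𝔤} {x y : 𝔤}
    (hx : x ∈ rootSpace H α) (hy : y ∈ rootSpace H (-α)) :
    ⁅x, y⁆ = form H x y • (sharp H α.toLinear : 𝔤) := by
  rw [lie_eq_killingForm_smul_of_mem_rootSpace_of_mem_rootSpace_neg hx hy, sharp,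
    Submodule.coe_smul_of_tower, smul_smul, form_apply, mul_right_comm, mul_inv_cancel₀ hs, one_mul]

/-- Root vectors for `α` and `-α` can be chosen dual to each other. -/
lemma exists_dual_root_vectors (hs : formScale H ≠ 0) (α : H.root) :
    ∃ e f : 𝔤, e ∈ rootSpace H (α : Weight ℂ H 𝔤) ∧ f ∈ rootSpace H (-(α : Weight ℂ H 𝔤)) ∧
      form H e f = 1 := by
  obtain ⟨h, e, f, t, he, hf⟩ :=
    exists_isSl2Triple_of_weight_isNonZero (LieSubalgebra.isNonZero_coe_root α)
  have hne : form H e f ≠ 0 := by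
    intro h0
    apply t.h_ne_zero
    rw [← t.lie_e_f, lie_eq_form_smul_sharp hs he hf, h0, zero_smul]
  exact ⟨e, (form H e f)⁻¹ • f, he, Submodule.smul_mem _ _ hf, by
    rw [map_smul, smul_eq_mul, inv_mul_cancel₀ hne]⟩

lemma ne_zero_of_form_eq_one {x y : 𝔤} (h : form H x y = 1) : x ≠ 0 ∧ y ≠ 0 := by
  constructor <;> rintro rfl <;> simp at h

/-- A bilinear expression in dual root vectors for `±α` does not depend on their choice. -/
lemma bilin_eq_of_dual_root_vectors {V : Type*} [AddCommGroup V] [Module ℂ V]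
    (F : 𝔤 →ₗ[ℂ] 𝔤 →ₗ[ℂ] V) (α : H.root) {e f e' f' : 𝔤}
    (he : e ∈ rootSpace H (α : Weight ℂ H 𝔤)) (hf : f ∈ rootSpace H (-(α : Weight ℂ H 𝔤)))
    (he' : e' ∈ rootSpace H (α : Weight ℂ H 𝔤)) (hf' : f' ∈ rootSpace H (-(α : Weight ℂ H 𝔤)))
    (h : form H e f = 1) (h' : form H e' f' = 1) : F e f = F e' f' := by
  have hα := LieSubalgebra.isNonZero_coe_root α
  obtain ⟨c, rfl⟩ := exists_smul_eq_of_mem_rootSpace hα he (ne_zero_of_form_eq_one h).1 he'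
  obtain ⟨d, rfl⟩ := exists_smul_eq_of_mem_rootSpace (α := -(α : Weight ℂ H 𝔤)) hα.neg
    hf (ne_zero_of_form_eq_one h).2 hf'
  have hcd : d * c = 1 := by simpa [h] using h'
  simp [smul_smul, hcd]

variable {κ κ' : Type*} [DecidableEq κ] [DecidableEq κ']

lemma formScale_ne_zero (B : Module.Basis κ ℂ 𝔤) [Nontrivial 𝔤]
    (hB : ∀ i j, form H (B i) (B j) = if i = j then 1 else 0) : formScale H ≠ 0 := by
  intro h
  obtain ⟨i⟩ := B.index_nonempty
  have := hB i i
  simp [form_apply, h] at this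

variable [Fintype κ] [Fintype κ']

/-- Expansion of a vector in an orthonormal basis, for a bilinear form. -/
lemma sum_form_smul {M : Type*} [AddCommGroup M] [Module ℂ M] (Q : M →ₗ[ℂ] M →ₗ[ℂ] ℂ)
    (B : Module.Basis κ ℂ M) (hB : ∀ i j, Q (B i) (B j) = if i = j then 1 else 0) (z : M) :
    ∑ i, Q (B i) z • B i = z := by
  conv_rhs => rw [← B.sum_repr z]
  refine Finset.sum_congr rfl fun i _ ↦ congrArg (· • B i) ?_
  conv_lhs => rw [← B.sum_repr z]
  simp only [map_sum, map_smul, hB, smul_eq_mul, mul_ite, mul_one, mul_zero, Finset.sum_ite_eq,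
    Finset.mem_univ, if_true]

/-- The canonical element of `𝔤 ⊗ 𝔤` may be computed from any pair of dual families. -/
lemma sum_bilin_eq_of_dual {V J : Type*} [AddCommGroup V] [Module ℂ V] [Fintype J]
    (F : 𝔤 →ₗ[ℂ] 𝔤 →ₗ[ℂ] V) (B : Module.Basis κ ℂ 𝔤)
    (hB : ∀ i j, form H (B i) (B j) = if i = j then 1 else 0) (x x' : J → 𝔤)
    (h : ∀ z, ∑ j, form H (x' j) z • x j = z) :
    ∑ a, F (B a) (B a) = ∑ j, F (x j) (x' j) := by
  calc ∑ a, F (B a) (B a) = ∑ a, F (∑ j, form H (x' j) (B a) • x j) (B a) := by simp only [h]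
    _ = ∑ j, ∑ a, form H (B a) (x' j) • F (x j) (B a) := by
        rw [Finset.sum_comm]
        simp [form_comm]
    _ = ∑ j, F (x j) (x' j) := by
        refine Finset.sum_congr rfl fun j _ ↦ ?_
        conv_rhs => rw [← sum_form_smul (form H) B hB (x' j)]
        simp

open scoped Classical in
/-- The root decomposition of a vector of `𝔤`, with respect to an orthonormal basis of `H` and dual
root vectors. -/
lemma sum_form_smul_root_decomposition (b : (rootSystem H).Base) (y : Module.Basis κ' ℂ H)
    (hy : ∀ i j, form H (y i : 𝔤) (y j : 𝔤) = if i = j then 1 else 0) (e f : H.root → 𝔤)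
    (he : ∀ α : H.root, e α ∈ rootSpace H (α : Weight ℂ H 𝔤))
    (hf : ∀ α : H.root, f α ∈ rootSpace H (-(α : Weight ℂ H 𝔤)))
    (hef : ∀ α : H.root, form H (e α) (f α) = 1) (z : 𝔤) :
    ∑ i, form H (y i : 𝔤) z • (y i : 𝔤) +
      (∑ α : {α // b.IsPos α}, form H (f α) z • e α +
        ∑ α : {α // b.IsPos α}, form H (e α) z • f α) = z := by
  let := (rootSystem H).indexNeg
  have hcoe (α : H.root) : ⇑((-α : H.root) : Weight ℂ H 𝔤) = -⇑(α : Weight ℂ H 𝔤) := by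
    ext h
    exact LinearMap.congr_fun (root_neg α) h
  have hinj {α β : H.root} (h : ⇑(α : Weight ℂ H 𝔤) = ⇑(β : Weight ℂ H 𝔤)) : α = β :=
    Subtype.ext (DFunLike.coe_injective h)
  have hz : z ∈ ⨆ χ : Weight ℂ H 𝔤, (rootSpace H χ).toSubmodule := by
    rw [← LieSubmodule.iSup_toSubmodule, iSup_genWeightSpace_eq_top' ℂ H 𝔤]
    trivial
  induction hz using Submodule.iSup_induction' with
  | zero => simp
  | add z z' _ _ h h' =>
    conv_rhs => rw [← h, ← h']
    simp only [map_add, add_smul, Finset.sum_add_distrib]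
    abel
  | mem χ z hz =>
    rw [LieSubmodule.mem_toSubmodule] at hz
    by_cases h0 : χ.IsZero
    · have hzH : z ∈ H := by
        rw [h0.eq, rootSpace_zero_eq ℂ 𝔤 H] at hz
        exact hz
      lift z to H using hzH
      simp only [form_comm _ (z : 𝔤), form_coe_eq_zero _ z (he _), form_coe_eq_zero_neg _ z (hf _)]
      simp only [zero_smul, Finset.sum_const_zero, add_zero]
      have := congrArg Subtype.val
        (sum_form_smul ((form H).compl₁₂ H.toSubmodule.subtype H.toSubmodule.subtype) y hy z)
      rw [AddSubmonoidClass.coe_finsetSum] at this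
      simpa [form_comm] using this
    · obtain ⟨γ, rfl⟩ : ∃ γ : H.root, (γ : Weight ℂ H 𝔤) = χ := ⟨⟨χ, by simpa using h0⟩, rfl⟩
      have hy0 : ∑ i, form H (y i : 𝔤) z • (y i : 𝔤) = 0 :=
        Finset.sum_eq_zero fun i _ ↦ by rw [form_coe_eq_zero γ _ hz, zero_smul]
      have hf0 (α : H.root) (h : α ≠ γ) : form H (f α) z = 0 := by
        refine form_eq_zero_of_add_ne_zero (hf α) hz fun h' ↦ h (hinj ?_)
        exact neg_add_eq_zero.1 h'
      have he0 (α : H.root) (h : α ≠ -γ) : form H (e α) z = 0 := by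
        refine form_eq_zero_of_add_ne_zero (he α) hz fun h' ↦ h (hinj ?_)
        rw [hcoe]
        exact eq_neg_of_add_eq_zero_left h'
      rw [hy0, zero_add]
      by_cases hγ : b.IsPos γ
      · have hng : ¬ b.IsPos (-γ) := fun h ↦ (RootPairing.Base.IsPos.neg_iff_not b γ).1 h hγ
        rw [Finset.sum_eq_single ⟨γ, hγ⟩ (fun α _ h ↦ by
            rw [hf0 _ (fun h' ↦ h (Subtype.ext h')), zero_smul]) (by simp),
          Finset.sum_eq_zero fun α _ ↦ by
            rw [he0 _ (fun h' ↦ hng (h' ▸ α.2)), zero_smul], add_zero]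
        obtain ⟨c, rfl⟩ := exists_smul_eq_of_mem_rootSpace
          (LieSubalgebra.isNonZero_coe_root γ) (he γ) (ne_zero_of_form_eq_one (hef γ)).1 hz
        rw [map_smul, form_comm, hef, smul_eq_mul, mul_one]
      · have hng : b.IsPos (-γ) := (RootPairing.Base.IsPos.neg_iff_not b γ).2 hγ
        rw [Finset.sum_eq_zero fun α _ ↦ by
            rw [hf0 _ (fun h' ↦ hγ (h' ▸ α.2)), zero_smul],
          Finset.sum_eq_single ⟨-γ, hng⟩ (fun α _ h ↦ by
            rw [he0 _ (fun h' ↦ h (Subtype.ext h')), zero_smul]) (by simp), zero_add]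
        have hfγ : f (-γ) ∈ rootSpace H (γ : Weight ℂ H 𝔤) := by
          have := hf (-γ)
          rwa [hcoe, neg_neg] at this
        obtain ⟨c, rfl⟩ := exists_smul_eq_of_mem_rootSpace
          (LieSubalgebra.isNonZero_coe_root γ) hfγ (ne_zero_of_form_eq_one (hef (-γ))).2 hz
        rw [map_smul, hef, smul_eq_mul, mul_one]

open scoped Classical in
/-- The canonical element of `𝔤 ⊗ 𝔤` in terms of an orthonormal basis of `H` and dual root
vectors. -/
lemma sum_bilin_eq_root_decomposition {V : Type*} [AddCommGroup V] [Module ℂ V]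
    (F : 𝔤 →ₗ[ℂ] 𝔤 →ₗ[ℂ] V) (B : Module.Basis κ ℂ 𝔤)
    (hB : ∀ i j, form H (B i) (B j) = if i = j then 1 else 0)
    (b : (rootSystem H).Base) (y : Module.Basis κ' ℂ H)
    (hy : ∀ i j, form H (y i : 𝔤) (y j : 𝔤) = if i = j then 1 else 0) (e f : H.root → 𝔤)
    (he : ∀ α : H.root, e α ∈ rootSpace H (α : Weight ℂ H 𝔤))
    (hf : ∀ α : H.root, f α ∈ rootSpace H (-(α : Weight ℂ H 𝔤)))
    (hef : ∀ α : H.root, form H (e α) (f α) = 1) :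
    ∑ a, F (B a) (B a) = ∑ i, F (y i) (y i) +
      (∑ α : {α // b.IsPos α}, F (e α) (f α) + ∑ α : {α // b.IsPos α}, F (f α) (e α)) := by
  let P := {α : H.root // b.IsPos α}
  rw [sum_bilin_eq_of_dual F B hB
    (Sum.elim (fun i ↦ (y i : 𝔤)) (Sum.elim (fun α : P ↦ e α) (fun α : P ↦ f α)))
    (Sum.elim (fun i ↦ (y i : 𝔤)) (Sum.elim (fun α : P ↦ f α) (fun α : P ↦ e α))) ?_]
  · simp only [Fintype.sum_sum_type, Sum.elim_inl, Sum.elim_inr]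
    rfl
  · intro z
    simp only [Fintype.sum_sum_type, Sum.elim_inl, Sum.elim_inr]
    exact sum_form_smul_root_decomposition b y hy e f he hf hef z

open scoped Classical in
/-- The sum of the `♯α` over the positive roots `α` is `2ρ`. -/
lemma sum_sharp_isPos (b : (rootSystem H).Base) :
    ∑ α : {α : H.root // b.IsPos α}, sharp H (α.1 : Weight ℂ H 𝔤).toLinear = (2 : ℂ) • rho b := by
  have hlin : ∑ α : {α : H.root // b.IsPos α}, sharp H (α.1 : Weight ℂ H 𝔤).toLinear =
      sharp H (∑ α : {α : H.root // b.IsPos α}, (rootSystem H).root α.1) := by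
    simp only [sharp, map_sum, Finset.smul_sum]
    rfl
  have hsum : ∑ α : H.root, (if b.IsPos α then (rootSystem H).root α else 0) =
      ∑ α : {α : H.root // b.IsPos α}, (rootSystem H).root α.1 := by
    rw [← Finset.sum_filter]
    exact Finset.sum_subtype _ (by simp) _
  rw [hlin, rho, rhoForm, hsum]
  simp only [sharp, map_smul, smul_smul]
  congr 1
  ring

end InvariantForm

/-! ### Operators on formal functions -/

section FormalFunctions

attribute [local instance 100] LieRing.ofAssociativeRing

variable {𝔞 𝔟 : Type*} [LieRing 𝔞] [LieAlgebra ℂ 𝔞] [LieRing 𝔟] [LieAlgebra ℂ 𝔟]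

@[simp] lemma ι_add (x y : 𝔞) : (ι (x + y) : U 𝔞) = ι x + ι y := map_add _ x y
@[simp] lemma ι_zero : (ι (0 : 𝔞) : U 𝔞) = 0 := map_zero _
@[simp] lemma ι_smul (c : ℂ) (x : 𝔞) : (ι (c • x) : U 𝔞) = c • ι x := map_smul _ c x
@[simp] lemma ι_neg (x : 𝔞) : (ι (-x) : U 𝔞) = -ι x := map_neg _ x

/-- The canonical map `𝔞 → U(𝔞)` as a linear map. -/
def ιLin (𝔞 : Type*) [LieRing 𝔞] [LieAlgebra ℂ 𝔞] : 𝔞 →ₗ[ℂ] U 𝔞 where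
  toFun := ι
  map_add' := ι_add
  map_smul' := ι_smul

@[simp] lemma ιLin_apply (x : 𝔞) : ιLin 𝔞 x = ι x := rfl

lemma ι_lie (x y : 𝔞) : (ι ⁅x, y⁆ : U 𝔞) = ι x * ι y - ι y * ι x := by
  rw [ι, LieHom.map_lie, LieRing.of_associative_ring_bracket]
  rfl

lemma ι_mul_ι (x y : 𝔞) : (ι x * ι y : U 𝔞) = ι y * ι x + ι ⁅x, y⁆ := by
  rw [ι_lie]; abel

@[simp] lemma mapU_ι (f : 𝔞 →ₗ⁅ℂ⁆ 𝔟) (x : 𝔞) : mapU f (ι x) = ι (f x) :=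
  UniversalEnvelopingAlgebra.lift_ι_apply ℂ _ x

lemma algHom_ext {A : Type*} [Ring A] [Algebra ℂ A] {F G : U 𝔞 →ₐ[ℂ] A}
    (h : ∀ x, F (ι x) = G (ι x)) : F = G :=
  UniversalEnvelopingAlgebra.hom_ext ℂ (LieHom.ext h)

/-- `U(𝔞)` is generated by `𝔞`. -/
lemma subalgebra_eq_top {S : Subalgebra ℂ (U 𝔞)} (hS : ∀ x, ι x ∈ S) : S = ⊤ := by
  let g : U 𝔞 →ₐ[ℂ] S := UniversalEnvelopingAlgebra.lift ℂ
    { toFun x := ⟨ι x, hS x⟩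
      map_add' x y := Subtype.ext (ι_add x y)
      map_smul' c x := Subtype.ext (ι_smul c x)
      map_lie' := by
        intro x y
        exact Subtype.ext (ι_lie x y) }
  have hg : S.val.comp g = AlgHom.id ℂ (U 𝔞) := algHom_ext fun x ↦
    congrArg Subtype.val (UniversalEnvelopingAlgebra.lift_ι_apply ℂ _ x)
  refine eq_top_iff.2 fun u _ ↦ ?_
  rw [show u = S.val (g u) from (AlgHom.congr_fun hg u).symm]
  exact (g u).2

@[simp] lemma L_apply (X : U 𝔞) (φ : Fun 𝔞) (u : U 𝔞) : L X φ u = φ (u * X) := rfl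
/-- `L` as a linear map. -/
def Llin : U 𝔞 →ₗ[ℂ] Module.End ℂ (Fun 𝔞) where
  toFun := L
  map_add' X Y := by ext; simp [mul_add]
  map_smul' c X := by ext; simp

/-- `L` is multiplicative for composition, without reversal of the order. -/
lemma L_mul (X Y : U 𝔞) : L (X * Y) = L X * L Y := by
  ext φ u; simp [mul_assoc]

lemma L_algebraMap (c : ℂ) : L (algebraMap ℂ (U 𝔞) c) = c • 1 := by
  ext φ u
  simp [Algebra.algebraMap_eq_smul_one]

/-- A character of `U(𝔞)` vanishes on brackets. -/
lemma character_ι_lie (χ : U 𝔞 →ₐ[ℂ] ℂ) (x y : 𝔞) : χ (ι ⁅x, y⁆) = 0 := by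
  rw [ι_lie, map_sub, map_mul, map_mul, mul_comm, sub_self]

variable [IsLieAbelian 𝔞]

/-- The automorphism of `U(𝔞)`, for abelian `𝔞`, translating `x ∈ 𝔞` by the scalar `l(x)`. -/
def shift (l : Module.Dual ℂ 𝔞) : U 𝔞 →ₐ[ℂ] U 𝔞 :=
  UniversalEnvelopingAlgebra.lift ℂ
    { toFun x := ι x + algebraMap ℂ (U 𝔞) (l x)
      map_add' x y := by simp only [ι_add, map_add]; abel
      map_smul' c x := by simp [Algebra.smul_def, mul_add]
      map_lie' := by
        intro x y
        have h : (ι x * ι y : U 𝔞) = ι y * ι x := by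
          rw [ι_mul_ι, trivial_lie_zero, ι_zero, add_zero]
        simp only [LieRing.of_associative_ring_bracket, mul_add, add_mul, h, ← map_mul,
          Algebra.commutes, trivial_lie_zero, map_zero, mul_comm (l x), ι_zero]
        abel }

@[simp] lemma shift_ι (l : Module.Dual ℂ 𝔞) (x : 𝔞) :
    shift l (ι x) = ι x + algebraMap ℂ (U 𝔞) (l x) :=
  UniversalEnvelopingAlgebra.lift_ι_apply ℂ _ x

@[simp] lemma shift_shift (l l' : Module.Dual ℂ 𝔞) (u : U 𝔞) :
    shift l (shift l' u) = shift (l + l') u := by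
  refine AlgHom.congr_fun (φ₁ := (shift l).comp (shift l')) (algHom_ext fun x ↦ ?_) u
  simp [add_assoc]

@[simp] lemma shift_zero (u : U 𝔞) : shift 0 u = u := by
  refine AlgHom.congr_fun (φ₂ := AlgHom.id ℂ (U 𝔞)) (algHom_ext fun x ↦ ?_) u
  simp

/-- Multiplication by `e^l` is dual to the translation of `U(𝔞)` by `l`. -/
lemma mul_expFun_apply (l : Module.Dual ℂ 𝔞) (ψ : Fun 𝔞) (u : U 𝔞) :
    mul (expFun l) ψ u = ψ (shift l u) := by
  let E : U 𝔞 →ₐ[ℂ] ℂ :=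
    UniversalEnvelopingAlgebra.lift ℂ (LieAlgebra.lieCharacterEquivLinearDual.symm l)
  let T : U 𝔞 ⊗[ℂ] U 𝔞 →ₐ[ℂ] U 𝔞 := (Algebra.TensorProduct.lid ℂ (U 𝔞)).toAlgHom.comp
    (Algebra.TensorProduct.map E (AlgHom.id ℂ (U 𝔞)))
  have hT : T.comp coproduct = shift l := by
    refine algHom_ext fun x ↦ ?_
    have h1 : coproduct (ι x) = ι x ⊗ₜ[ℂ] (1 : U 𝔞) + (1 : U 𝔞) ⊗ₜ[ℂ] ι x :=
      UniversalEnvelopingAlgebra.lift_ι_apply ℂ _ x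
    have h2 : E (ι x) = l x := UniversalEnvelopingAlgebra.lift_ι_apply ℂ _ x
    simp [T, h1, h2, Algebra.algebraMap_eq_smul_one, add_comm]
  have hφ : (TensorProduct.lid ℂ ℂ).toLinearMap ∘ₗ TensorProduct.map (expFun l) ψ =
      ψ ∘ₗ T.toLinearMap := by
    ext a c
    simp [T, expFun, E]
  rw [← hT]
  exact LinearMap.congr_fun hφ (coproduct u)

/-- The automorphism `x ↦ -x` of an abelian Lie algebra, tangent to the inversion of the group. -/
def negHom : 𝔞 →ₗ⁅ℂ⁆ 𝔞 :=
  { (-LinearMap.id : 𝔞 →ₗ[ℂ] 𝔞) with map_lie' := by intro x y; simp [trivial_lie_zero] }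

@[simp] lemma negHom_apply (x : 𝔞) : negHom x = -x := rfl

lemma inversion_apply (ψ : Fun 𝔞) (u : U 𝔞) : inversion ψ u = ψ (mapU negHom u) := rfl

lemma mapU_negHom_mapU_negHom (u : U 𝔞) : mapU negHom (mapU negHom u) = u := by
  refine AlgHom.congr_fun (φ₁ := (mapU negHom).comp (mapU negHom)) (φ₂ := AlgHom.id ℂ (U 𝔞))
    (algHom_ext fun x ↦ ?_) u
  simp

lemma mul_expFun_mul_L_mul_expFun_neg (l : Module.Dual ℂ 𝔞) (X : U 𝔞) :
    mul (expFun l) * L X * mul (expFun (-l)) = L (shift (-l) X) := by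
  ext ψ u
  simp [mul_expFun_apply]

lemma mul_expFun_mul_expFun_mul_expFun_neg (l l' : Module.Dual ℂ 𝔞) :
    mul (expFun l) * mul (expFun l') * mul (expFun (-l)) = mul (expFun l') := by
  ext ψ u
  simp only [Module.End.mul_apply, mul_expFun_apply, shift_shift]
  rw [add_comm l', neg_add_cancel_left]

lemma inversion_mul_mul_expFun_mul_inversion (l : Module.Dual ℂ 𝔞) :
    inversion * mul (expFun l) * inversion = mul (expFun (-l)) := by
  ext ψ u
  simp only [Module.End.mul_apply, inversion_apply, mul_expFun_apply]
  congr 1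
  refine AlgHom.congr_fun (φ₁ := (mapU negHom).comp ((shift l).comp (mapU negHom)))
    (φ₂ := shift (-l)) (algHom_ext fun x ↦ ?_) u
  simp [add_comm]

lemma inversion_mul_L_mul_inversion (X : U 𝔞) :
    inversion * L X * inversion = L (mapU negHom X) := by
  ext ψ u
  simp only [Module.End.mul_apply, inversion_apply, L_apply, map_mul, mapU_negHom_mapU_negHom]

end FormalFunctions

/-! ### Conjugation of the radial part -/

section TodaOperator

variable {𝔤 : Type*} [LieRing 𝔤] [LieAlgebra ℂ 𝔤] [FiniteDimensional ℂ 𝔤] [IsKilling ℂ 𝔤]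
  {H : LieSubalgebra ℂ 𝔤} [H.IsCartanSubalgebra] {κ : Type*} [Fintype κ]

lemma innerForm_apply (x h : H) : innerForm x h = form H (x : 𝔤) (h : 𝔤) := rfl

omit [FiniteDimensional ℂ 𝔤] [IsKilling ℂ 𝔤] [H.IsCartanSubalgebra] in
lemma laplacian_eq_L (y : κ → H) : laplacian y = L (∑ i, ι (y i) * ι (y i)) := by
  change _ = Llin _
  rw [map_sum]
  exact Finset.sum_congr rfl fun i _ ↦ (L_mul _ _).symm

lemma sum_form_smul_cartan [DecidableEq κ] (y : Module.Basis κ ℂ H)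
    (hy : ∀ i j, form H (y i : 𝔤) (y j : 𝔤) = if i = j then 1 else 0) (x : H) :
    ∑ i, form H (y i : 𝔤) (x : 𝔤) • y i = x :=
  sum_form_smul ((form H).compl₁₂ H.toSubmodule.subtype H.toSubmodule.subtype) y hy x

lemma conjRho_add (b : (rootSystem H).Base) (D D' : Module.End ℂ (Fun H)) :
    conjRho b (D + D') = conjRho b D + conjRho b D' := by
  simp only [conjRho, mul_add, add_mul]

lemma conjRho_smul (b : (rootSystem H).Base) (c : ℂ) (D : Module.End ℂ (Fun H)) :
    conjRho b (c • D) = c • conjRho b D := by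
  simp only [conjRho, mul_smul_comm, smul_mul_assoc]

lemma conjRho_L (b : (rootSystem H).Base) (X : U H) :
    conjRho b (L X) = L (shift (-innerForm (rho b)) X) :=
  mul_expFun_mul_L_mul_expFun_neg _ X

lemma conjRho_potential (b : (rootSystem H).Base) (θ : H.root) (β : Option b.support → ℂ) :
    conjRho b (potential b θ β) = potential b θ β := by
  simp only [conjRho, potential, Finset.mul_sum, Finset.sum_mul, mul_smul_comm, smul_mul_assoc,
    mul_expFun_mul_expFun_mul_expFun_neg]

/-- The shift of the Laplacian by `ρ` produces the first order term `-2 ∂_ρ`, which cancels that of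
the radial part. -/
lemma shift_sum_sq [DecidableEq κ] (y : Module.Basis κ ℂ H)
    (hy : ∀ i j, form H (y i : 𝔤) (y j : 𝔤) = if i = j then 1 else 0) (x : H) :
    shift (-innerForm x) (∑ i, ι (y i) * ι (y i)) =
      ∑ i, ι (y i) * ι (y i) - (2 : ℂ) • ι x + algebraMap ℂ (U H) (form H (x : 𝔤) (x : 𝔤)) := by
  have hx : (ι x : U H) = ∑ i, form H (y i : 𝔤) (x : 𝔤) • ι (y i) := by
    conv_lhs => rw [← sum_form_smul_cartan y hy x]
    rw [← ιLin_apply, map_sum]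
    exact Finset.sum_congr rfl fun i _ ↦ ι_smul _ _
  have hxx : form H (x : 𝔤) (x : 𝔤) =
      ∑ i, form H (y i : 𝔤) (x : 𝔤) * form H (y i : 𝔤) (x : 𝔤) := by
    have := congrArg (fun z ↦ innerForm x z) (sum_form_smul_cartan y hy x)
    rw [← innerForm_apply, ← this, map_sum]
    refine Finset.sum_congr rfl fun i _ ↦ ?_
    rw [map_smul, smul_eq_mul, innerForm_apply, form_comm (x : 𝔤)]
  rw [hx, hxx, map_sum, map_sum, Finset.smul_sum, ← Finset.sum_sub_distrib,
    ← Finset.sum_add_distrib]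
  refine Finset.sum_congr rfl fun i _ ↦ ?_
  rw [map_mul, shift_ι, LinearMap.neg_apply, innerForm_apply, form_comm (x : 𝔤)]
  simp only [Algebra.algebraMap_eq_smul_one, add_mul, mul_add, smul_mul_assoc, mul_smul_comm,
    one_mul, mul_one, smul_smul]
  module

/-- Conjugation by `e^{(ρ,h)}` removes the first order term of the radial part. -/
lemma conjRho_radialPart [DecidableEq κ] (b : (rootSystem H).Base) (θ : H.root)
    (y : Module.Basis κ ℂ H)
    (hy : ∀ i j, form H (y i : 𝔤) (y j : 𝔤) = if i = j then 1 else 0)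
    (β : Option b.support → ℂ) :
    conjRho b (radialPart b θ y β) =
      laplacian y + (2 : ℂ) • potential b θ β - form H (rho b : 𝔤) (rho b : 𝔤) • 1 := by
  have hderiv : conjRho b (deriv (rho b)) =
      deriv (rho b) - form H (rho b : 𝔤) (rho b : 𝔤) • 1 := by
    rw [deriv, conjRho_L, shift_ι, ← L_algebraMap, LinearMap.neg_apply, innerForm_apply, map_neg,
      ← sub_eq_add_neg]
    exact map_sub Llin _ _
  have hlap : conjRho b (laplacian y) =
      laplacian y - (2 : ℂ) • deriv (rho b) + form H (rho b : 𝔤) (rho b : 𝔤) • 1 := by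
    rw [laplacian_eq_L, conjRho_L, shift_sum_sq y hy, ← L_algebraMap]
    change Llin _ = _
    rw [map_add, map_sub, map_smul]
    rfl
  rw [radialPart, conjRho_add, conjRho_add, conjRho_smul, conjRho_smul, conjRho_potential, hderiv,
    hlap]
  module

/-- The inversion `h ↦ -h` preserves the Laplacian and changes `e^{-α_i}` into `e^{α_i}`. -/
lemma inversion_conjRho_radialPart [DecidableEq κ] (b : (rootSystem H).Base) (θ : H.root)
    (y : Module.Basis κ ℂ H)
    (hy : ∀ i j, form H (y i : 𝔤) (y j : 𝔤) = if i = j then 1 else 0)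
    (K : ℂ) (β : Option b.support → ℂ) (h0 : β none = -K) (h1 : ∀ i, β (some i) = -1) :
    inversion *
        ((-(1 / 2) : ℂ) •
          (conjRho b (radialPart b θ y β) + form H (rho b : 𝔤) (rho b : 𝔤) • 1)) *
        inversion =
      affineToda b θ y K := by
  have hlap : inversion * laplacian y * inversion = laplacian (𝔤 := 𝔤) (y : κ → H) := by
    rw [laplacian_eq_L, inversion_mul_L_mul_inversion]
    simp
  have hpot : inversion * potential b θ β * inversion =
      -(∑ i : b.support, mul (expFun ((rootSystem H).root i)) +
        K • mul (expFun (-(rootSystem H).root θ))) := by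
    simp only [potential, Fintype.sum_option, mul_add, add_mul, Finset.mul_sum, Finset.sum_mul,
      mul_smul_comm, smul_mul_assoc, inversion_mul_mul_expFun_mul_inversion, h0, h1, affRoot,
      neg_neg, ← Finset.smul_sum]
    module
  rw [conjRho_radialPart b θ y hy, sub_add_cancel, mul_smul_comm, smul_mul_assoc, mul_add,
    add_mul, mul_smul_comm, smul_mul_assoc, hlap, hpot, affineToda]
  module

end TodaOperator

/-! ### Characters of `𝔫̂₊` -/

section Characters

variable {𝔤 : Type*} [LieRing 𝔤] [LieAlgebra ℂ 𝔤] [FiniteDimensional ℂ 𝔤] [IsKilling ℂ 𝔤]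
  {H : LieSubalgebra ℂ 𝔤} [H.IsCartanSubalgebra] {b : (rootSystem H).Base}

/-- The linear map `x ↦ x ⊗ t^m`. -/
def loopLin (H : LieSubalgebra ℂ 𝔤) [H.IsCartanSubalgebra] (m : ℤ) : 𝔤 →ₗ[ℂ] Affine H where
  toFun x := loop H x m
  map_add' x y := by simpa using Affine.mk_add H x y m 0 0
  map_smul' c x := by simpa using Affine.mk_smul H c x m 0

@[simp] lemma loopLin_apply (m : ℤ) (x : 𝔤) : loopLin H m x = loop H x m := rfl

/-- The cocycle does not contribute to the bracket of two loops of total degree `≠ 0`, nor to that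
of two constant loops. -/
lemma lie_loop (x y : 𝔤) {m n : ℤ} (h : m + n ≠ 0 ∨ m = 0) :
    ⁅loop H x m, loop H y n⁆ = loop H ⁅x, y⁆ (m + n) := by
  rw [Affine.lie_mk]
  congr 1
  rcases h with h | rfl
  · exact if_neg h
  · simp

lemma loop_mem_affNPos (x : 𝔤) {m : ℤ} (hm : 0 < m) : loop H x m ∈ affNPos b :=
  Submodule.subset_span ⟨x, m, Or.inl hm, rfl⟩

lemma loop_zero_mem_affNPos {α : H.root} (hα : b.IsPos α) {x : 𝔤}
    (hx : x ∈ rootSpace H (α : Weight ℂ H 𝔤)) : loop H x 0 ∈ affNPos b :=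
  Submodule.subset_span ⟨x, 0, Or.inr ⟨rfl, Submodule.mem_iSup_of_mem ⟨α, hα⟩ hx⟩, rfl⟩

/-- The linear functional `x ↦ χ(x ⊗ t^m)` on `𝔤`, for a character `χ` of `𝔫̂₊` and `m > 0`. -/
def charCoeff (χ : U (affNPos b) →ₐ[ℂ] ℂ) {m : ℤ} (hm : 0 < m) : 𝔤 →ₗ[ℂ] ℂ :=
  χ.toLinearMap ∘ₗ ιLin (affNPos b) ∘ₗ
    (loopLin H m).codRestrict (affNPos b).toSubmodule (fun x ↦ loop_mem_affNPos x hm)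

lemma charCoeff_apply (χ : U (affNPos b) →ₐ[ℂ] ℂ) {m : ℤ} (hm : 0 < m) (x : 𝔤) :
    charCoeff χ hm x = χ (ι ⟨loop H x m, loop_mem_affNPos x hm⟩) := rfl

/-- A character vanishes on `t^m 𝔤` for `m ≥ 2`: the algebra `𝔤` is perfect. -/
lemma charCoeff_eq_zero_of_one_lt [LieAlgebra.IsSimple ℂ 𝔤] (χ : U (affNPos b) →ₐ[ℂ] ℂ) {m : ℤ}
    (hm : 1 < m) (x : 𝔤) : charCoeff χ (zero_lt_one.trans hm) x = 0 := by
  have hperf : derivedSeries ℂ 𝔤 1 = ⊤ := by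
    refine (IsSimple.eq_bot_or_eq_top (R := ℂ) _).resolve_left fun h ↦ ?_
    exact IsSimple.non_abelian (R := ℂ) (L := 𝔤) (by
      rwa [← lie_abelian_iff_equiv_lie_abelian (LieIdeal.topEquiv (R := ℂ) (L := 𝔤)),
        abelian_iff_derived_one_eq_bot])
  have hx : x ∈ Submodule.span ℂ {⁅x, y⁆ | (x : 𝔤) (y : 𝔤)} := by
    rw [← coe_derivedSeries_one_eq, hperf]
    trivial
  induction hx using Submodule.span_induction with
  | zero => exact map_zero _
  | add x y _ _ hx hy => rw [map_add, hx, hy, add_zero]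
  | smul c x _ hx => rw [map_smul, hx, smul_zero]
  | mem x hx =>
    obtain ⟨x, y, rfl⟩ := hx
    rw [charCoeff_apply, ← character_ι_lie χ ⟨loop H x 1, loop_mem_affNPos x zero_lt_one⟩
      ⟨loop H y (m - 1), loop_mem_affNPos y (by lia)⟩]
    congr 2
    refine Subtype.ext ?_
    change _ = ⁅loop H x 1, loop H y (m - 1)⁆
    rw [lie_loop _ _ (Or.inl (by lia)), add_sub_cancel]

/-- The functional `x ↦ χ(x ⊗ t)` vanishes on `[𝔫₊, 𝔤]`. -/
lemma charCoeff_lie_eq_zero (χ : U (affNPos b) →ₐ[ℂ] ℂ) {α : H.root} (hα : b.IsPos α) {x : 𝔤}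
    (hx : x ∈ rootSpace H (α : Weight ℂ H 𝔤)) (y : 𝔤) :
    charCoeff χ zero_lt_one ⁅x, y⁆ = 0 := by
  rw [charCoeff_apply, ← character_ι_lie χ ⟨loop H x 0, loop_zero_mem_affNPos hα hx⟩
    ⟨loop H y 1, loop_mem_affNPos y zero_lt_one⟩]
  congr 2
  refine Subtype.ext ?_
  change _ = ⁅loop H x 0, loop H y 1⁆
  rw [lie_loop _ _ (Or.inl (by lia)), zero_add]

lemma charCoeff_rootSpace_eq_zero (χ : U (affNPos b) →ₐ[ℂ] ℂ) {α : H.root} (hα : b.IsPos α)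
    {x : 𝔤} (hx : x ∈ rootSpace H (α : Weight ℂ H 𝔤)) : charCoeff χ zero_lt_one x = 0 := by
  have h := charCoeff_lie_eq_zero χ hα hx (coroot (α : Weight ℂ H 𝔤) : 𝔤)
  have hl : ⁅(coroot (α : Weight ℂ H 𝔤) : 𝔤), x⁆ = (2 : ℂ) • x := by
    rw [← root_apply_coroot (LieSubalgebra.isNonZero_coe_root α)]
    exact lie_eq_smul_of_mem_rootSpace hx _
  rw [← lie_skew, hl, map_neg, map_smul, neg_eq_zero, smul_eq_zero] at h
  exact h.resolve_left two_ne_zero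

lemma charCoeff_cartan_eq_zero (χ : U (affNPos b) →ₐ[ℂ] ℂ) (h : H) :
    charCoeff χ zero_lt_one (h : 𝔤) = 0 := by
  have hh : h ∈ Submodule.span ℂ ((rootSystem H).coroot '' b.support) := by
    rw [b.span_coroot_support]
    exact (RootPairing.IsRootSystem.span_coroot_eq_top (P := rootSystem H)).ge Submodule.mem_top
  induction hh using Submodule.span_induction with
  | zero => exact map_zero _
  | add x y _ _ hx hy => rw [AddMemClass.coe_add, map_add, hx, hy, add_zero]
  | smul c x _ hx => rw [Submodule.coe_smul_of_tower, map_smul, hx, smul_zero]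
  | mem x hx =>
    obtain ⟨α, hα, rfl⟩ := hx
    have hα0 := LieSubalgebra.isNonZero_coe_root α
    obtain ⟨h', e, f, t, he, hf⟩ := exists_isSl2Triple_of_weight_isNonZero hα0
    rw [rootSystem_coroot_apply, ← t.h_eq_coroot hα0 he hf, ← t.lie_e_f]
    exact charCoeff_lie_eq_zero χ (RootPairing.Base.isPos_of_mem_support hα) he f

/-- A character of `𝔫̂₊` vanishes on `f_α ⊗ t` unless `α` is the maximal root `θ`. -/
lemma charCoeff_rootSpace_neg_eq_zero (χ : U (affNPos b) →ₐ[ℂ] ℂ) {θ α : H.root}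
    (hθ : IsMaximalRoot b θ) (hα : b.IsPos α) (hne : α ≠ θ) {x : 𝔤}
    (hx : x ∈ rootSpace H (-(α : Weight ℂ H 𝔤))) : charCoeff χ zero_lt_one x = 0 := by
  obtain ⟨β, γ, hβ, hγ⟩ := exists_isPos_root_add hθ hα hne
  have hγ' : ⇑(γ : Weight ℂ H 𝔤) = ⇑(α : Weight ℂ H 𝔤) + ⇑(β : Weight ℂ H 𝔤) := by
    ext h
    exact LinearMap.congr_fun hγ h
  obtain ⟨y, hy, z, -, rfl⟩ := exists_lie_eq_of_mem_rootSpace (β := -(γ : Weight ℂ H 𝔤))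
    (γ := -(α : Weight ℂ H 𝔤)) (LieSubalgebra.isNonZero_coe_root β)
    (LieSubalgebra.isNonZero_coe_root α).neg
    (by rw [Weight.coe_neg, Weight.coe_neg, hγ']; abel) hx
  exact charCoeff_lie_eq_zero χ hβ hy z

/-- A character of `𝔫̂₊` vanishes on the root vectors of the nonsimple positive roots. -/
lemma character_rootSpace_eq_zero (χ : U (affNPos b) →ₐ[ℂ] ℂ) {α : H.root} (hα : b.IsPos α)
    (hs : α ∉ b.support) {x : 𝔤} (hx : x ∈ rootSpace H (α : Weight ℂ H 𝔤)) :
    χ (ι ⟨loop H x 0, loop_zero_mem_affNPos hα hx⟩) = 0 := by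
  obtain ⟨i, hi, β, hβ, h⟩ := exists_root_eq_simple_add hα hs
  obtain ⟨y, hy, z, hz, rfl⟩ := exists_lie_eq_of_mem_rootSpace
    (LieSubalgebra.isNonZero_coe_root i) (LieSubalgebra.isNonZero_coe_root α)
    (β := (β : Weight ℂ H 𝔤)) (by ext a; exact LinearMap.congr_fun h a) hx
  rw [← character_ι_lie χ ⟨loop H y 0, loop_zero_mem_affNPos
      (RootPairing.Base.isPos_of_mem_support hi) hy⟩
    ⟨loop H z 0, loop_zero_mem_affNPos hβ hz⟩]
  congr 2
  refine Subtype.ext ?_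
  change _ = ⁅loop H y 0, loop H z 0⁆
  rw [lie_loop _ _ (Or.inr rfl), zero_add]

lemma IsMaximalRoot.isPos {θ : H.root} (hθ : IsMaximalRoot b θ) : b.IsPos θ := by
  have : Nonempty H.root := ⟨θ⟩
  obtain ⟨i, hi⟩ := b.support_nonempty
  refine isPos_of_root_mem_closure ?_
  rw [← sub_add_cancel ((rootSystem H).root θ) ((rootSystem H).root i)]
  exact add_mem (hθ i) (AddSubmonoid.subset_closure ⟨i, hi, rfl⟩)

end Characters

/-! ### Whittaker functions -/

section Whittaker

variable {𝔤 : Type*} [LieRing 𝔤] [LieAlgebra ℂ 𝔤] [FiniteDimensional ℂ 𝔤] [IsKilling ℂ 𝔤]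
  {H : LieSubalgebra ℂ 𝔤} [H.IsCartanSubalgebra] {b : (rootSystem H).Base}

lemma res_apply (φ : Fun (Affine H)) (u : U H) :
    res φ u = φ (mapU ((const H).comp H.incl) u) := rfl

@[simp] lemma mapU_const_incl_ι (h : H) :
    mapU ((const H).comp H.incl) (ι h) = ι (loop H (h : 𝔤) 0) := mapU_ι _ h

lemma res_L_mapU (X : U H) (φ : Fun (Affine H)) :
    res (L (mapU ((const H).comp H.incl) X) φ) = L X (res φ) := by
  ext u
  simp only [res_apply, L_apply, map_mul]

/-- Moving a vector of weight `l` to the left past `u ∈ U(H)` translates `u` by `l`. -/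
lemma mapU_mul_ι_loop (l : Module.Dual ℂ H) {x : 𝔤} (hx : ∀ h : H, ⁅(h : 𝔤), x⁆ = l h • x) (m : ℤ)
    (u : U H) : mapU ((const H).comp H.incl) u * ι (loop H x m) =
      ι (loop H x m) * mapU ((const H).comp H.incl) (shift l u) := by
  let S : Subalgebra ℂ (U H) :=
    { carrier := {u | mapU ((const H).comp H.incl) u * ι (loop H x m) =
        ι (loop H x m) * mapU ((const H).comp H.incl) (shift l u)}
      mul_mem' := by
        intro u w hu hw
        simp only [Set.mem_ofPred_eq] at hu hw ⊢
        rw [map_mul, mul_assoc, hw, ← mul_assoc, hu, mul_assoc, map_mul, map_mul]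
      add_mem' := by
        intro u w hu hw
        simp only [Set.mem_ofPred_eq] at hu hw ⊢
        rw [map_add, add_mul, hu, hw, map_add, map_add, mul_add]
      algebraMap_mem' := by
        intro c
        simp only [Set.mem_ofPred_eq, AlgHom.commutes, Algebra.commutes] }
  have hS : S = ⊤ := subalgebra_eq_top fun h ↦ by
    change mapU ((const H).comp H.incl) (ι h) * ι (loop H x m) =
      ι (loop H x m) * mapU ((const H).comp H.incl) (shift l (ι h))
    rw [mapU_const_incl_ι, ι_mul_ι, lie_loop _ _ (Or.inr rfl), hx, zero_add, shift_ι, map_add,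
      mapU_const_incl_ι, AlgHom.commutes, mul_add, ← loopLin_apply m (l h • x), map_smul, ι_smul,
      Algebra.algebraMap_eq_smul_one, mul_smul_comm, mul_one, loopLin_apply]
  exact hS.ge Algebra.mem_top

/-- The bilinear map `(x, y) ↦ (L((x ⊗ t^m)(y ⊗ t^n)) φ)|_H`. -/
def resL₂ (φ : Fun (Affine H)) (m n : ℤ) : 𝔤 →ₗ[ℂ] 𝔤 →ₗ[ℂ] Fun H :=
  ((LinearMap.mul ℂ (U (Affine H))).compl₁₂ (ιLin (Affine H) ∘ₗ loopLin H m)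
    (ιLin (Affine H) ∘ₗ loopLin H n)).compr₂ (res ∘ₗ Llin.flip φ)

lemma resL₂_apply (φ : Fun (Affine H)) (m n : ℤ) (x y : 𝔤) :
    resL₂ φ m n x y = res (L (ι (loop H x m) * ι (loop H y n)) φ) := rfl

variable {θ : H.root} {χp : U (affNPos b) →ₐ[ℂ] ℂ} {χm : U (affNNeg b) →ₐ[ℂ] ℂ}
  {φ : Fun (Affine H)}

lemma IsWhittaker.apply_mul_ι (hφ : IsWhittaker b θ χp χm φ) (p : affNPos b) (u : U (Affine H)) :
    φ (u * ι (p : Affine H)) = χp (ι p) * φ u := by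
  have := LinearMap.congr_fun (hφ.right (ι p)) u
  rwa [mapU_ι] at this

lemma IsWhittaker.apply_ι_mul (hφ : IsWhittaker b θ χp χm φ) (q : affNNeg b) (u : U (Affine H)) :
    φ (ι (q : Affine H) * u) = χm (ι q) * φ u := by
  have := LinearMap.congr_fun (hφ.left (ι q)) u
  rwa [mapU_ι] at this

lemma IsWhittaker.resL₂_eq_zero (hφ : IsWhittaker b θ χp χm φ) {m n : ℤ} (x : 𝔤) {y : 𝔤}
    (hy : loop H y n ∈ affNPos b) (h : χp (ι ⟨loop H y n, hy⟩) = 0) : resL₂ φ m n x y = 0 := by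
  ext u
  rw [resL₂_apply, res_apply, L_apply, ← mul_assoc]
  exact (hφ.apply_mul_ι ⟨_, hy⟩ _).trans (by rw [h, zero_mul]; rfl)

/-- A normally ordered product of root vectors acts on the restriction of a Whittaker function by
multiplication by an exponential. -/
lemma IsWhittaker.resL₂_eq (hφ : IsWhittaker b θ χp χm φ) {m n : ℤ} {x y : 𝔤}
    (hx : loop H x m ∈ affNNeg b) (hy : loop H y n ∈ affNPos b) (l : Module.Dual ℂ H)
    (hl : ∀ h : H, ⁅(h : 𝔤), x⁆ = l h • x) :
    resL₂ φ m n x y =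
      (χp (ι ⟨loop H y n, hy⟩) * χm (ι ⟨loop H x m, hx⟩)) • mul (expFun l) (res φ) := by
  ext u
  rw [resL₂_apply, res_apply, L_apply, ← mul_assoc, LinearMap.smul_apply, mul_expFun_apply,
    res_apply, smul_eq_mul, mapU_mul_ι_loop l hl, mul_assoc (χp _), ← hφ.apply_ι_mul]
  exact hφ.apply_mul_ι ⟨_, hy⟩ _

lemma resL₂_cartan (φ : Fun (Affine H)) (h : H) :
    resL₂ φ 0 0 (h : 𝔤) (h : 𝔤) = (deriv h * deriv h) (res φ) := by
  rw [resL₂_apply, ← mapU_const_incl_ι, ← map_mul, res_L_mapU, deriv, L_mul]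

/-- Exchanging dual root vectors `e`, `f` for `±α` produces the derivative along `♯α`. -/
lemma resL₂_swap (hs : formScale H ≠ 0) (φ : Fun (Affine H)) {α : H.root} {e f : 𝔤}
    (he : e ∈ rootSpace H (α : Weight ℂ H 𝔤)) (hf : f ∈ rootSpace H (-(α : Weight ℂ H 𝔤)))
    (hef : form H e f = 1) :
    resL₂ φ 0 0 e f =
      resL₂ φ 0 0 f e + deriv (sharp H (α : Weight ℂ H 𝔤).toLinear) (res φ) := by
  rw [resL₂_apply, resL₂_apply, ι_mul_ι, lie_loop _ _ (Or.inr rfl), zero_add,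
    lie_eq_form_smul_sharp hs he hf, hef, one_smul, ← mapU_const_incl_ι, deriv, ← res_L_mapU,
    ← map_add]
  exact congrArg res (LinearMap.congr_fun (map_add Llin _ _) φ)

variable {κ : Type*}

/-- The monomials of loop degree `m ≥ 2` do not contribute. -/
lemma IsWhittaker.res_L_casimirMonomial_eq_zero [LieAlgebra.IsSimple ℂ 𝔤]
    (hφ : IsWhittaker b θ χp χm φ) (B : κ → 𝔤) {p : ℕ+ × κ} (hp : p.1 ≠ 1) :
    res (L (casimirMonomial B p) φ) = 0 := by
  have h1 : 1 < ((p.1 : ℕ) : ℤ) := by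
    have := lt_of_le_of_ne p.1.pos fun h ↦ hp (PNat.coe_eq_one_iff.1 h.symm)
    exact_mod_cast this
  exact hφ.resL₂_eq_zero _ _ (charCoeff_eq_zero_of_one_lt χp h1 _)

variable [Fintype κ]

lemma res_L_casimir (φ : Fun (Affine H)) (B : κ → 𝔤) :
    res (L (mapU (const H) (casimir B)) φ) = ∑ a, resL₂ φ 0 0 (B a) (B a) := by
  have : mapU (const H) (casimir B) = ∑ a, ι (loop H (B a) 0) * ι (loop H (B a) 0) := by
    simp only [casimir, map_sum, map_mul, mapU_ι]
    rfl
  rw [this]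
  change (res ∘ₗ Llin.flip φ) _ = _
  rw [map_sum]
  rfl

lemma IsWhittaker.finite_support [LieAlgebra.IsSimple ℂ 𝔤]
    (hφ : IsWhittaker b θ χp χm φ) (B : κ → 𝔤) :
    {p : ℕ+ × κ | res (L (casimirMonomial B p) φ) ≠ 0}.Finite := by
  refine (Set.finite_range fun a : κ ↦ ((1 : ℕ+), a)).subset fun p hp ↦ ⟨p.2, ?_⟩
  have : p.1 = 1 := by
    by_contra h
    exact hp (hφ.res_L_casimirMonomial_eq_zero B h)
  exact Prod.ext this.symm rfl

lemma IsWhittaker.finsum_casimirMonomial [LieAlgebra.IsSimple ℂ 𝔤]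
    (hφ : IsWhittaker b θ χp χm φ) (B : κ → 𝔤) :
    ∑ᶠ p : ℕ+ × κ, res (L (casimirMonomial B p) φ) = ∑ a, resL₂ φ (-1) 1 (B a) (B a) := by
  rw [finsum_eq_sum_of_support_subset (s := {1} ×ˢ Finset.univ), Finset.sum_product,
    Finset.sum_singleton]
  · rfl
  · intro p hp
    have : p.1 = 1 := by
      by_contra h
      exact hp (hφ.res_L_casimirMonomial_eq_zero B h)
    exact Finset.mem_coe.2 (Finset.mem_product.2 ⟨Finset.mem_singleton.2 this, Finset.mem_univ _⟩)

variable {κ' : Type*} [Fintype κ'] [DecidableEq κ] [DecidableEq κ']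

lemma lie_eq_neg_smul {α : H.root} {f : 𝔤} (hf : f ∈ rootSpace H (-(α : Weight ℂ H 𝔤))) (h : H) :
    ⁅(h : 𝔤), f⁆ = (-(rootSystem H).root α) h • f :=
  lie_eq_smul_of_mem_rootSpace hf h

/-- The contribution of the finite-dimensional Casimir: the Laplacian, the term `2 ∂_ρ` and the
exponentials attached to the simple roots of `𝔤`. -/
lemma IsWhittaker.sum_resL₂_zero (hφ : IsWhittaker b θ χp χm φ) (v : RootVectors b θ)
    (hs : formScale H ≠ 0) (B : Module.Basis κ ℂ 𝔤)
    (hB : ∀ i j, form H (B i) (B j) = if i = j then 1 else 0) (y : Module.Basis κ' ℂ H)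
    (hy : ∀ i j, form H (y i : 𝔤) (y j : 𝔤) = if i = j then 1 else 0) :
    ∑ a, resL₂ φ 0 0 (B a) (B a) = laplacian y (res φ) + (2 : ℂ) • deriv (rho b) (res φ) +
      (2 : ℂ) • ∑ i : b.support, (χp (ι (v.affE (some i))) * χm (ι (v.affF (some i)))) •
        mul (expFun (-(rootSystem H).root i)) (res φ) := by
  classical
  choose e f he hf hef using exists_dual_root_vectors hs
  have hsimple (i : b.support) : resL₂ φ 0 0 (f i) (e i) =
      (χp (ι (v.affE (some i))) * χm (ι (v.affF (some i)))) •
        mul (expFun (-(rootSystem H).root i)) (res φ) := by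
    have h := bilin_eq_of_dual_root_vectors (resL₂ φ 0 0).flip i.1 (he i) (hf i) (v.e_mem i)
      (v.f_mem i) (hef i) (v.form_e_f i)
    simp only [LinearMap.flip_apply] at h
    rw [h]
    exact hφ.resL₂_eq (v.affF (some i)).2 (v.affE (some i)).2 _ (lie_eq_neg_smul (v.f_mem i))
  have hsum : ∑ α : {α // b.IsPos α}, resL₂ φ 0 0 (f α) (e α) =
      ∑ i : b.support, (χp (ι (v.affE (some i))) * χm (ι (v.affF (some i)))) •
        mul (expFun (-(rootSystem H).root i)) (res φ) := by
    simp only [← hsimple]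
    rw [Finset.sum_coe_sort b.support fun α ↦ resL₂ φ 0 0 (f α) (e α),
      ← Finset.sum_subtype (Finset.univ.filter b.IsPos) (by simp)
        fun α ↦ resL₂ φ 0 0 (f α) (e α)]
    symm
    refine Finset.sum_subset (fun α hα ↦ ?_) fun α hα hα' ↦ ?_
    · simpa using RootPairing.Base.isPos_of_mem_support hα
    · exact hφ.resL₂_eq_zero _ _
        (character_rootSpace_eq_zero χp (Finset.mem_filter.1 hα).2 hα' (he α))
  have hderiv : ∑ α : {α : H.root // b.IsPos α},
      deriv (sharp H (α.1 : Weight ℂ H 𝔤).toLinear) (res φ) =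
        (2 : ℂ) • deriv (rho b) (res φ) := by
    have := congrArg (Llin.flip (res φ) ∘ₗ ιLin H) (sum_sharp_isPos b)
    rwa [map_sum, map_smul] at this
  have hlap : ∑ i, resL₂ φ 0 0 (y i : 𝔤) (y i : 𝔤) = laplacian y (res φ) := by
    simp only [resL₂_cartan, laplacian, LinearMap.sum_apply]
  rw [sum_bilin_eq_root_decomposition (resL₂ φ 0 0) B hB b y hy e f he hf hef, hlap,
    Finset.sum_congr rfl fun (α : {α // b.IsPos α}) _ ↦
      resL₂_swap hs φ (he α) (hf α) (hef α), Finset.sum_add_distrib, hderiv, hsum]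
  module

/-- The contribution of the monomials of loop degree one: the exponential attached to the affine
simple root `α_0 = -θ`. -/
lemma IsWhittaker.sum_resL₂_one (hφ : IsWhittaker b θ χp χm φ) (hθ : IsMaximalRoot b θ)
    (v : RootVectors b θ) (hs : formScale H ≠ 0) (B : Module.Basis κ ℂ 𝔤)
    (hB : ∀ i j, form H (B i) (B j) = if i = j then 1 else 0) (y : Module.Basis κ' ℂ H)
    (hy : ∀ i j, form H (y i : 𝔤) (y j : 𝔤) = if i = j then 1 else 0) :
    ∑ a, resL₂ φ (-1) 1 (B a) (B a) =
      (χp (ι (v.affE none)) * χm (ι (v.affF none))) •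
        mul (expFun ((rootSystem H).root θ)) (res φ) := by
  classical
  choose e f he hf hef using exists_dual_root_vectors hs
  have hzero {x z : 𝔤} (h : charCoeff χp zero_lt_one z = 0) : resL₂ φ (-1) 1 x z = 0 :=
    hφ.resL₂_eq_zero _ _ h
  rw [sum_bilin_eq_root_decomposition (resL₂ φ (-1) 1) B hB b y hy e f he hf hef,
    Finset.sum_eq_zero fun i _ ↦ hzero (charCoeff_cartan_eq_zero χp (y i)),
    Finset.sum_eq_zero (s := Finset.univ)
      (f := fun α : {α : H.root // b.IsPos α} ↦ resL₂ φ (-1) 1 (f α) _)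
      fun α _ ↦ hzero (charCoeff_rootSpace_eq_zero χp α.2 (he α)),
    Finset.sum_eq_single (⟨θ, hθ.isPos⟩ : {α : H.root // b.IsPos α}) (fun α _ hα ↦ hzero
      (charCoeff_rootSpace_neg_eq_zero χp hθ α.2 (fun h ↦ hα (Subtype.ext h)) (hf α))) (by simp),
    zero_add, add_zero,
    bilin_eq_of_dual_root_vectors _ θ (he θ) (hf θ) v.eθ_mem v.fθ_mem (hef θ) v.form_eθ_fθ]
  exact hφ.resL₂_eq (v.affF none).2 (v.affE none).2 _ (lie_eq_smul_of_mem_rootSpace v.eθ_mem)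

/-- The radial part of the Casimir operator on Whittaker functions. -/
lemma IsWhittaker.radialPart_eq [LieAlgebra.IsSimple ℂ 𝔤] (hφ : IsWhittaker b θ χp χm φ)
    (hθ : IsMaximalRoot b θ)
    (v : RootVectors b θ) (hs : formScale H ≠ 0) (B : Module.Basis κ ℂ 𝔤)
    (hB : ∀ i j, form H (B i) (B j) = if i = j then 1 else 0) (y : Module.Basis κ' ℂ H)
    (hy : ∀ i j, form H (y i : 𝔤) (y j : 𝔤) = if i = j then 1 else 0) :
    res (L (mapU (const H) (casimir B)) φ) +
        (2 : ℂ) • ∑ᶠ p : ℕ+ × κ, res (L (casimirMonomial B p) φ) =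
      radialPart b θ y (fun i ↦ χp (ι (v.affE i)) * χm (ι (v.affF i))) (res φ) := by
  have hpot : potential b θ (fun i ↦ χp (ι (v.affE i)) * χm (ι (v.affF i))) (res φ) =
      (χp (ι (v.affE none)) * χm (ι (v.affF none))) •
        mul (expFun ((rootSystem H).root θ)) (res φ) +
      ∑ i : b.support, (χp (ι (v.affE (some i))) * χm (ι (v.affF (some i)))) •
        mul (expFun (-(rootSystem H).root i)) (res φ) := by
    simp only [potential, Fintype.sum_option, affRoot, neg_neg, LinearMap.add_apply,
      LinearMap.sum_apply, LinearMap.smul_apply]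
  rw [res_L_casimir, hφ.finsum_casimirMonomial, hφ.sum_resL₂_zero v hs B hB y hy,
    hφ.sum_resL₂_one hθ v hs B hB y hy, radialPart, LinearMap.add_apply, LinearMap.add_apply,
    LinearMap.smul_apply, LinearMap.smul_apply, hpot]
  module

end Whittaker

end AffineToda

end

open AffineToda in
theorem proposition2p3 {𝔤 : Type*} [LieRing 𝔤] [LieAlgebra ℂ 𝔤] [FiniteDimensional ℂ 𝔤]
    [LieAlgebra.IsSimple ℂ 𝔤] (H : LieSubalgebra ℂ 𝔤) [H.IsCartanSubalgebra]
    (b : (LieAlgebra.IsKilling.rootSystem H).Base) (θ : H.root) (hθ : IsMaximalRoot b θ)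
    (v : RootVectors b θ)
    {κ κ' : Type*} [Fintype κ] [DecidableEq κ] [Fintype κ'] [DecidableEq κ']
    (B : Module.Basis κ ℂ 𝔤) (hB : ∀ i j, form H (B i) (B j) = if i = j then 1 else 0)
    (y : Module.Basis κ' ℂ H)
    (hy : ∀ i j, form H (y i : 𝔤) (y j : 𝔤) = if i = j then 1 else 0) :
    (∀ (χp : U (affNPos b) →ₐ[ℂ] ℂ) (χm : U (affNNeg b) →ₐ[ℂ] ℂ) (φ : Fun (Affine H)),
      IsWhittaker b θ χp χm φ →
        {p : ℕ+ × κ | res (L (casimirMonomial B p) φ) ≠ 0}.Finite ∧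
        res (L (mapU (const H) (casimir B)) φ) +
            (2 : ℂ) • ∑ᶠ p : ℕ+ × κ, res (L (casimirMonomial B p) φ) =
          radialPart b θ y (fun i ↦ χp (ι (v.affE i)) * χm (ι (v.affF i))) (res φ)) ∧
    (∀ β : Option b.support → ℂ,
      conjRho b (radialPart b θ y β) =
        laplacian y + (2 : ℂ) • potential b θ β - form H (rho b) (rho b) • 1) ∧
    (∀ (K : ℂ) (β : Option b.support → ℂ), β none = -K → (∀ i, β (some i) = -1) →
      inversion *
          ((-(1 / 2) : ℂ) • (conjRho b (radialPart b θ y β) + form H (rho b) (rho b) • 1)) *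
          inversion =
        affineToda b θ y K) := by
  have : Nontrivial 𝔤 := not_subsingleton_iff_nontrivial.1 fun _ ↦
    LieAlgebra.IsSimple.non_abelian (R := ℂ) (L := 𝔤) ⟨fun _ _ ↦ Subsingleton.elim _ _⟩
  have hs := formScale_ne_zero B hB
  exact ⟨fun _ _ _ hφ ↦ ⟨hφ.finite_support B, hφ.radialPart_eq hθ v hs B hB y hy⟩,
    conjRho_radialPart b θ y hy, inversion_conjRho_radialPart b θ y hy⟩
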